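/- Let $s,f$ be the following transformations of $\mathbb Z$, acting on the right: $x^s=x-1$ if $x$ is odd and $x^s=x+1$ if $x$ is even; and $$x^f=\begin{cases}x-2^n-1&\text{if }x\equiv 3\cdot 2^n\pmod{2^{n+2}}\text{ for some }n\ge0,\\ x+3\cdot 2^n-1&\text{if }x\equiv 2^n\pmod{2^{n+2}}\text{ for some }n\ge0,\\ -1&\text{if }x=0\end{cases}$$ (every integer falls in exactly one case, for a unique $n$ in the first two). Let $F=\langle s,f\rangle$ be the semigroup they generate (it contains the identity, since $s^2=1$). For a semigroup generated by a finite set $Q$ of transformations, let $\|g\|$ be the least $\ell\ge0$ such that $g$ is a product of $\ell$ elements of $Q$ (the identity, as the empty product, has norm $0$), let $\gamma_Q(\ell)=\#\{g:\|g\|\le\ell\}$, and let the Gelfand–Kirillov dimension be the infimum of the real numbers $a$ such that $\gamma_Q(\ell)/\ell^a\to0$ as $\ell\to\infty$. Write $\gamma=\gamma_{\{s,f\}}$ for the ball growth function of $F$. **Theorem.** Let $\varphi=(1+\sqrt5)/2$, $\alpha=1+\log2/\log\varphi$ (so $|\alpha-2.44|<0.005$), and $$C=\frac{2\,(\sqrt5)^{\alpha}}{\sqrt5\,\varphi^2(2\varphi-1)(2\varphi)^{\alpha}}>0,\qquad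 D=\frac{2\,(\sqrt5)^{\alpha}}{\sqrt5\,\varphi^2(2\varphi-1)}>0 .$$ Then $C\ell^\alpha\le\gamma(\ell)$ for all $\ell\in\mathbb N$, and $\gamma(\ell)\le D\ell^\alpha$ for all $\ell\ge3$; moreover there is a constant $D'>0$ with $\gamma(\ell)\le D'\ell^\alpha$ for all $\ell\ge1$. Consequently the Gelfand–Kirillov dimension of $F$ is $\alpha$ (computed with respect to $\{s,f\}$, and likewise with respect to any finite set $Q$ generating $F$ as a semigroup), and $\alpha$ is irrational. -/

import Mathlib

namespace MealyGrowth

/-! ### Word norm, balls and growth in a semigroup -/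

section Growth

variable {M : Type*} [Monoid M]

/-- The norm of `g` with respect to a generating set `Q`: the least `ℓ` such that `g` is a product
`q₁ ⋯ q_ℓ` of `ℓ` elements of `Q` (only used for `g` generated by `Q`). The identity of the
monoid is the empty product, of norm `0`. -/
noncomputable def wordNorm (Q : Set M) (g : M) : ℕ :=
  sInf {ℓ : ℕ | ∃ w : List M, w.length = ℓ ∧ (∀ q ∈ w, q ∈ Q) ∧ w.prod = g}

/-- The ball growth function `γ(ℓ) = #{g ∈ ⟨Q⟩ : ‖g‖ ≤ ℓ}` of the semigroup generated by `Q`. -/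
noncomputable def ballGrowth (Q : Set M) (ℓ : ℕ) : ℕ :=
  {g : M | g ∈ Subsemigroup.closure Q ∧ wordNorm Q g ≤ ℓ}.ncard

/-- The Gelfand-Kirillov dimension of the semigroup generated by `Q`, computed with respect to
`Q`: the infimum of the real exponents `a` such that `γ(ℓ) / ℓ ^ a` converges to `0`
(it is `⊤` if there is no such exponent). -/
noncomputable def gkDim (Q : Set M) : EReal :=
  sInf {x : EReal | ∃ a : ℝ, x = (a : EReal) ∧
    Filter.Tendsto (fun ℓ : ℕ => (ballGrowth Q ℓ : ℝ) / (ℓ : ℝ) ^ a) Filter.atTop (nhds 0)}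

end Growth

/-! ### The transformations `s` and `f` of the integers, and the semigroup they generate -/

/-- The map `x ↦ x ^ s`. -/
def sMap (x : ℤ) : ℤ := if Odd x then x - 1 else x + 1

open Classical in
/-- The map `x ↦ x ^ f`. The exponent `n` in the first two cases is unique, and the last case is
the case `x = 0`; see `fMap_of_three`, `fMap_of_one` and `fMap_zero`. -/
noncomputable def fMap (x : ℤ) : ℤ :=
  if h : ∃ n : ℕ, x ≡ 3 * 2 ^ n [ZMOD 2 ^ (n + 2)] then x - 2 ^ h.choose - 1
  else if h : ∃ n : ℕ, x ≡ 2 ^ n [ZMOD 2 ^ (n + 2)] then x + 3 * 2 ^ h.choose - 1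
  else -1

/-- An integer congruent to `c * 2 ^ n` modulo `2 ^ (n + 2)` with `c` odd determines `n` and
`c` modulo `4`. -/
theorem exponent_unique {x c d : ℤ} {m n : ℕ} (hc : Odd c) (hd : Odd d)
    (h : x ≡ c * 2 ^ m [ZMOD 2 ^ (m + 2)]) (h' : x ≡ d * 2 ^ n [ZMOD 2 ^ (n + 2)]) :
    m = n ∧ c ≡ d [ZMOD 4] := by
  obtain ⟨k, hk⟩ := h.dvd
  obtain ⟨l, hl⟩ := h'.dvd
  obtain ⟨a, rfl⟩ := hc
  obtain ⟨b, rfl⟩ := hd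
  rcases lt_trichotomy m n with hmn | rfl | hmn
  · obtain ⟨t, rfl⟩ := Nat.exists_eq_add_of_lt hmn
    have h2 : (2 : ℤ) ^ m * (2 * a + 1 - 4 * k) = 2 ^ m * (2 * (2 ^ t * (2 * b + 1 - 4 * l))) := by
      linear_combination hk - hl
    have := mul_left_cancel₀ (by positivity) h2
    omega
  · have h2 : (2 : ℤ) ^ m * (2 * a + 1 - 4 * k) = 2 ^ m * (2 * b + 1 - 4 * l) := by
      linear_combination hk - hl
    have := mul_left_cancel₀ (by positivity) h2
    exact ⟨rfl, by unfold Int.ModEq; omega⟩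
  · obtain ⟨t, rfl⟩ := Nat.exists_eq_add_of_lt hmn
    have h2 : (2 : ℤ) ^ n * (2 * b + 1 - 4 * l) = 2 ^ n * (2 * (2 ^ t * (2 * a + 1 - 4 * k))) := by
      linear_combination hl - hk
    have := mul_left_cancel₀ (by positivity) h2
    omega

theorem fMap_of_three {x : ℤ} {n : ℕ} (h : x ≡ 3 * 2 ^ n [ZMOD 2 ^ (n + 2)]) :
    fMap x = x - 2 ^ n - 1 := by
  have hx : ∃ n : ℕ, x ≡ 3 * 2 ^ n [ZMOD 2 ^ (n + 2)] := ⟨n, h⟩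
  have := (exponent_unique (by decide) (by decide) hx.choose_spec h).1
  rw [fMap, dif_pos hx, this]

theorem fMap_of_one {x : ℤ} {n : ℕ} (h : x ≡ 2 ^ n [ZMOD 2 ^ (n + 2)]) :
    fMap x = x + 3 * 2 ^ n - 1 := by
  rw [← one_mul ((2 : ℤ) ^ n)] at h
  have hno : ¬ ∃ n : ℕ, x ≡ 3 * 2 ^ n [ZMOD 2 ^ (n + 2)] := fun ⟨m, hm⟩ =>
    absurd (exponent_unique (by decide) (by decide) hm h).2 (by decide)
  have hx : ∃ n : ℕ, x ≡ 2 ^ n [ZMOD 2 ^ (n + 2)] := ⟨n, by simpa using h⟩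
  have h1 := hx.choose_spec
  rw [← one_mul ((2 : ℤ) ^ hx.choose)] at h1
  have := (exponent_unique (by decide) (by decide) h1 h).1
  rw [fMap, dif_neg hno, dif_pos hx, this]

theorem fMap_zero : fMap 0 = -1 := by
  have key : ∀ (c : ℤ) (n : ℕ), Odd c → ¬ (0 : ℤ) ≡ c * 2 ^ n [ZMOD 2 ^ (n + 2)] := by
    rintro c n ⟨a, rfl⟩ h
    obtain ⟨k, hk⟩ := h.dvd
    have h2 : (2 : ℤ) ^ n * (2 * a + 1) = 2 ^ n * (4 * k) := by
      linear_combination hk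
    have := mul_left_cancel₀ (by positivity) h2
    omega
  rw [fMap, dif_neg (fun ⟨n, h⟩ => key 3 n (by decide) h),
    dif_neg (fun ⟨n, h⟩ => key 1 n (by decide) (by simpa using h))]

/-- Transformations of `X` acting on the right: in the product `g * h`, the map `g` is applied
first, that is, `x ^ (g * h) = (x ^ g) ^ h`. -/
abbrev RightTransf (X : Type*) : Type _ := (Function.End X)ᵐᵒᵖ

/-- The transformation `s` of `ℤ`. -/
def s : RightTransf ℤ := MulOpposite.op (sMap : ℤ → ℤ)

/-- The transformation `f` of `ℤ`. -/
noncomputable def f : RightTransf ℤ := MulOpposite.op (fMap : ℤ → ℤ)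

/-- The semigroup `F = ⟨s, f⟩`. -/
noncomputable def F : Subsemigroup (RightTransf ℤ) := Subsemigroup.closure {s, f}

/-- The ball growth function of `F`, with respect to the generators `s` and `f`. -/
noncomputable def γ : ℕ → ℕ := ballGrowth ({s, f} : Set (RightTransf ℤ))

/-! ### The constants -/

/-- The exponent `α = 1 + log 2 / log φ`. -/
noncomputable def α : ℝ := 1 + Real.log 2 / Real.log Real.goldenRatio

/-- The constant of the upper bound. -/
noncomputable def D : ℝ :=
  2 * √5 ^ α / (√5 * Real.goldenRatio ^ 2 * (2 * Real.goldenRatio - 1))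

/-- The constant of the lower bound. -/
noncomputable def C : ℝ :=
  2 * √5 ^ α / (√5 * Real.goldenRatio ^ 2 * (2 * Real.goldenRatio - 1)
    * (2 * Real.goldenRatio) ^ α)

end MealyGrowth

namespace MealyGrowth

/-! ### The wreath recursion -/

theorem sMap_even (y : ℤ) : sMap (2 * y) = 2 * y + 1 := by
  rw [sMap, if_neg (by simp)]

theorem sMap_odd (y : ℤ) : sMap (2 * y + 1) = 2 * y := by
  rw [sMap, if_pos ⟨y, rfl⟩]; ring

theorem sMap_sMap (x : ℤ) : sMap (sMap x) = x := by
  rcases Int.even_or_odd' x with ⟨y, rfl | rfl⟩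
  · rw [sMap_even, sMap_odd]
  · rw [sMap_odd, sMap_even]

theorem exists_exponent {x : ℤ} (hx : x ≠ 0) :
    ∃ n : ℕ, x ≡ 3 * 2 ^ n [ZMOD 2 ^ (n + 2)] ∨ x ≡ 2 ^ n [ZMOD 2 ^ (n + 2)] := by
  have hfin : FiniteMultiplicity (2 : ℤ) x := Int.finiteMultiplicity_iff.2 ⟨by decide, hx⟩
  obtain ⟨m, hm, hodd⟩ := hfin.exists_eq_pow_mul_and_not_dvd
  set n := multiplicity 2 x
  have hpow : (2 : ℤ) ^ (n + 2) = 2 ^ n * 4 := by ring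
  have h4 : m ≡ 3 [ZMOD 4] ∨ m ≡ 1 [ZMOD 4] := by unfold Int.ModEq; omega
  refine ⟨n, h4.imp (fun h => ?_) fun h => ?_⟩
  · rw [hm, hpow, mul_comm 3]; exact h.mul_left'
  · rw [hm, hpow]; simpa using h.mul_left' (c := 2 ^ n)

theorem fMap_even (y : ℤ) : fMap (2 * y) = 2 * fMap y + 1 := by
  rcases eq_or_ne y 0 with rfl | hy
  · simp [fMap_zero]
  · obtain ⟨n, h | h⟩ := exists_exponent hy
    · have h' : 2 * y ≡ 3 * 2 ^ (n + 1) [ZMOD 2 ^ (n + 1 + 2)] := by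
        have := h.mul_left' (c := 2)
        convert this using 1 <;> ring
      rw [fMap_of_three h, fMap_of_three h']; ring
    · have h' : 2 * y ≡ 2 ^ (n + 1) [ZMOD 2 ^ (n + 1 + 2)] := by
        have := h.mul_left' (c := 2)
        convert this using 1 <;> ring
      rw [fMap_of_one h, fMap_of_one h']; ring

theorem fMap_odd (y : ℤ) : fMap (2 * y + 1) = 2 * sMap y + 1 := by
  rcases Int.even_or_odd' y with ⟨z, rfl | rfl⟩
  · rw [fMap_of_one (n := 0) (by simp [Int.ModEq]; omega), sMap_even]; ring
  · rw [fMap_of_three (n := 0) (by simp [Int.ModEq]; omega), sMap_odd]; ring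

theorem transf_ext {g h : RightTransf ℤ}
    (h0 : ∀ y : ℤ, g.unop (2 * y) = h.unop (2 * y))
    (h1 : ∀ y : ℤ, g.unop (2 * y + 1) = h.unop (2 * y + 1)) : g = h := by
  apply MulOpposite.unop_injective
  funext x
  rcases Int.even_or_odd' x with ⟨y, rfl | rfl⟩
  · exact h0 y
  · exact h1 y

theorem mul_apply (g h : RightTransf ℤ) (x : ℤ) : (g * h).unop x = h.unop (g.unop x) := rfl

theorem one_apply (x : ℤ) : (1 : RightTransf ℤ).unop x = x := rfl

theorem s_apply (x : ℤ) : s.unop x = sMap x := rfl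

theorem f_apply (x : ℤ) : f.unop x = fMap x := rfl

/-- The transformation with odd image whose sections at `0` and `1` are `f * h` and `s * h`. -/
noncomputable def lift (h : RightTransf ℤ) : RightTransf ℤ :=
  MulOpposite.op fun x : ℤ =>
    if Even x then 2 * h.unop (fMap (x / 2)) + 1 else 2 * h.unop (sMap (x / 2)) + 1

theorem lift_even (h : RightTransf ℤ) (y : ℤ) :
    (lift h).unop (2 * y) = 2 * h.unop (fMap y) + 1 := by
  change (if Even (2 * y) then 2 * h.unop (fMap (2 * y / 2)) + 1 else _) = _
  rw [if_pos (even_two_mul y), Int.mul_ediv_cancel_left _ two_ne_zero]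

theorem lift_odd (h : RightTransf ℤ) (y : ℤ) :
    (lift h).unop (2 * y + 1) = 2 * h.unop (sMap y) + 1 := by
  have h2 : (2 * y + 1) / 2 = y := by omega
  have h3 : ¬ Even (2 * y + 1) := by simp
  change (if Even (2 * y + 1) then _ else 2 * h.unop (sMap ((2 * y + 1) / 2)) + 1) = _
  rw [if_neg h3, h2]

theorem s_mul_s : s * s = 1 := by
  apply MulOpposite.unop_injective
  funext x
  exact sMap_sMap x

theorem s_mul_cancel (g : RightTransf ℤ) : s * (s * g) = g := by
  rw [← mul_assoc, s_mul_s, one_mul]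

theorem mul_s_cancel (g : RightTransf ℤ) : g * s * s = g := by
  rw [mul_assoc, s_mul_s, mul_one]

theorem s_mul_inj {g h : RightTransf ℤ} : s * g = s * h ↔ g = h :=
  ⟨fun e => by rw [← s_mul_cancel g, e, s_mul_cancel], fun e => by rw [e]⟩

theorem mul_s_inj {g h : RightTransf ℤ} : g * s = h * s ↔ g = h :=
  ⟨fun e => by rw [← mul_s_cancel g, e, mul_s_cancel], fun e => by rw [e]⟩

theorem lift_one : lift 1 = f :=
  transf_ext (fun y => by rw [lift_even, f_apply, fMap_even, one_apply])
    (fun y => by rw [lift_odd, f_apply, fMap_odd, one_apply])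

theorem lift_mul_s (h : RightTransf ℤ) : lift (h * s) = lift h * f :=
  transf_ext
    (fun y => by rw [mul_apply, lift_even, lift_even, f_apply, fMap_odd, mul_apply, s_apply])
    (fun y => by rw [mul_apply, lift_odd, lift_odd, f_apply, fMap_odd, mul_apply, s_apply])

theorem lift_mul_f (h : RightTransf ℤ) : lift (h * f) = lift h * s * f :=
  transf_ext
    (fun y => by
      rw [mul_apply, mul_apply, lift_even, lift_even, s_apply, sMap_odd, f_apply, fMap_even,
        mul_apply, f_apply])
    (fun y => by
      rw [mul_apply, mul_apply, lift_odd, lift_odd, s_apply, sMap_odd, f_apply, fMap_even,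
        mul_apply, f_apply])

theorem f_mul_lift (h : RightTransf ℤ) : f * lift h = lift (s * h) :=
  transf_ext
    (fun y => by rw [mul_apply, f_apply, fMap_even, lift_odd, lift_even, mul_apply, s_apply])
    (fun y => by rw [mul_apply, f_apply, fMap_odd, lift_odd, lift_odd, mul_apply, s_apply])

theorem f_mul_s_mul_lift (h : RightTransf ℤ) : f * (s * lift h) = lift (f * h) :=
  transf_ext
    (fun y => by
      rw [mul_apply, mul_apply, f_apply, fMap_even, s_apply, sMap_odd, lift_even, lift_even,
        mul_apply, f_apply])
    (fun y => by
      rw [mul_apply, mul_apply, f_apply, fMap_odd, s_apply, sMap_odd, lift_even, lift_odd,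
        mul_apply, f_apply])


theorem lift_injective : Function.Injective lift := by
  intro h k e
  apply MulOpposite.unop_injective
  funext x
  have := congrArg (fun g : RightTransf ℤ => g.unop (2 * sMap x + 1)) e
  simp only [lift_odd, sMap_sMap] at this
  exact (by omega : h.unop x = k.unop x)

theorem lift_inj {h k : RightTransf ℤ} : lift h = lift k ↔ h = k := lift_injective.eq_iff

theorem s_mul_lift_even (h : RightTransf ℤ) (y : ℤ) :
    (s * lift h).unop (2 * y) = 2 * h.unop (sMap y) + 1 := by
  rw [mul_apply, s_apply, sMap_even, lift_odd]

theorem s_mul_lift_odd (h : RightTransf ℤ) (y : ℤ) :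
    (s * lift h).unop (2 * y + 1) = 2 * h.unop (fMap y) + 1 := by
  rw [mul_apply, s_apply, sMap_odd, lift_even]

theorem lift_eq_s_mul_lift {h k : RightTransf ℤ} :
    lift h = s * lift k ↔ h = s * (f * k) ∧ k = s * (f * h) := by
  constructor
  · intro e
    have e0 : f * h = s * k := by
      apply MulOpposite.unop_injective
      funext y
      have := congrArg (fun g : RightTransf ℤ => g.unop (2 * y)) e
      simp only [lift_even, s_mul_lift_even] at this
      exact (by omega : h.unop (fMap y) = k.unop (sMap y))
    have e1 : s * h = f * k := by
      apply MulOpposite.unop_injective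
      funext y
      have := congrArg (fun g : RightTransf ℤ => g.unop (2 * y + 1)) e
      simp only [lift_odd, s_mul_lift_odd] at this
      exact (by omega : h.unop (sMap y) = k.unop (fMap y))
    exact ⟨by rw [← e1, s_mul_cancel], by rw [e0, s_mul_cancel]⟩
  · rintro ⟨e1, e2⟩
    have e0 : f * h = s * k := by rw [← s_mul_inj, s_mul_cancel, ← e2]
    have e1 : s * h = f * k := by rw [← s_mul_inj, s_mul_cancel, ← e1]
    refine transf_ext (fun y => ?_) (fun y => ?_)
    · rw [lift_even, s_mul_lift_even]
      have := congrArg (fun g : RightTransf ℤ => g.unop y) e0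
      simp only [mul_apply, s_apply, f_apply] at this
      rw [this]
    · rw [lift_odd, s_mul_lift_odd]
      have := congrArg (fun g : RightTransf ℤ => g.unop y) e1
      simp only [mul_apply, s_apply, f_apply] at this
      rw [this]

/-- A transformation all of whose values are odd. -/
def OddValued (g : RightTransf ℤ) : Prop := ∀ x, Odd (g.unop x)

theorem oddValued_lift (h : RightTransf ℤ) : OddValued (lift h) := by
  intro x
  rcases Int.even_or_odd' x with ⟨y, rfl | rfl⟩
  · rw [lift_even]; exact odd_two_mul_add_one _
  · rw [lift_odd]; exact odd_two_mul_add_one _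

theorem OddValued.mul_left {g : RightTransf ℤ} (hg : OddValued g) (k : RightTransf ℤ) :
    OddValued (k * g) := fun x => hg (k.unop x)

theorem OddValued.ne_mul_s {g h : RightTransf ℤ} (hg : OddValued g) (hh : OddValued h) :
    g ≠ h * s := by
  intro e
  have h0 := hg 0
  rw [e, mul_apply, s_apply] at h0
  obtain ⟨y, hy⟩ := hh 0
  rw [hy, sMap_odd] at h0
  exact Int.not_even_iff_odd.2 h0 (even_two_mul y)

theorem OddValued.ne_one {g : RightTransf ℤ} (hg : OddValued g) : g ≠ 1 := by
  rintro rfl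
  have := hg 0
  rw [one_apply] at this
  simp at this

theorem OddValued.ne_s {g : RightTransf ℤ} (hg : OddValued g) : g ≠ s := by
  rintro rfl
  have := hg 1
  rw [s_apply, show (1 : ℤ) = 2 * 0 + 1 by norm_num, sMap_odd] at this
  simp at this

/-! ### Weighted words -/

/-- `Reach a b ℓ g`: the transformation `g` is a product of generators of total weight `ℓ`, where
`s` has weight `a` and `f` has weight `b`. -/
inductive Reach (a b : ℕ) : ℕ → RightTransf ℤ → Prop
  | one : Reach a b 0 1
  | mul_s {ℓ : ℕ} {g : RightTransf ℤ} : Reach a b ℓ g → Reach a b (ℓ + a) (g * s)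
  | mul_f {ℓ : ℕ} {g : RightTransf ℤ} : Reach a b ℓ g → Reach a b (ℓ + b) (g * f)

theorem Reach.s_mul {a b ℓ : ℕ} {g : RightTransf ℤ} (h : Reach a b ℓ g) :
    Reach a b (ℓ + a) (s * g) := by
  induction h with
  | one => simpa using Reach.mul_s (Reach.one (a := a) (b := b))
  | mul_s _ ih => rw [← mul_assoc]; exact ih.mul_s
  | mul_f _ ih => rw [← mul_assoc, add_right_comm]; exact ih.mul_f

theorem Reach.lift {a b ℓ : ℕ} {h : RightTransf ℤ} (hr : Reach b (a + b) ℓ h) :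
    Reach a b (ℓ + b) (lift h) := by
  induction hr with
  | one => rw [lift_one, ← one_mul f]; exact Reach.one.mul_f
  | mul_s _ ih => rw [lift_mul_s]; exact ih.mul_f
  | @mul_f m _ _ ih =>
    rw [lift_mul_f, show m + (a + b) + b = m + b + a + b by ring]; exact ih.mul_s.mul_f

/-- The possible shapes of an element of the semigroup, with bounds for the weight of its
section. -/
theorem Reach.cases_lift {a b ℓ : ℕ} {g : RightTransf ℤ} (hr : Reach a b ℓ g) :
    g = 1 ∨ (g = s ∧ a ≤ ℓ) ∨ ∃ h m, Reach b (a + b) m h ∧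
      ((g = MealyGrowth.lift h ∧ m + b ≤ ℓ) ∨
        (g = s * MealyGrowth.lift h ∧ m + b + a ≤ ℓ) ∨
        (g = MealyGrowth.lift h * s ∧ m + b + a ≤ ℓ) ∨
        (g = s * MealyGrowth.lift h * s ∧ m + b + a + a ≤ ℓ)) := by
  induction hr with
  | one => exact Or.inl rfl
  | mul_s _ ih =>
    rcases ih with rfl | ⟨rfl, h⟩ | ⟨h, m, hm, ⟨rfl, hl⟩ | ⟨rfl, hl⟩ | ⟨rfl, hl⟩ | ⟨rfl, hl⟩⟩
    · exact Or.inr (Or.inl ⟨one_mul _, by omega⟩)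
    · exact Or.inl s_mul_s
    · exact Or.inr (Or.inr ⟨h, m, hm, Or.inr (Or.inr (Or.inl ⟨rfl, by omega⟩))⟩)
    · exact Or.inr (Or.inr ⟨h, m, hm, Or.inr (Or.inr (Or.inr ⟨rfl, by omega⟩))⟩)
    · exact Or.inr (Or.inr ⟨h, m, hm, Or.inl ⟨mul_s_cancel _, by omega⟩⟩)
    · exact Or.inr (Or.inr ⟨h, m, hm, Or.inr (Or.inl ⟨mul_s_cancel _, by omega⟩)⟩)
  | mul_f _ ih =>
    rcases ih with rfl | ⟨rfl, h⟩ | ⟨h, m, hm, ⟨rfl, hl⟩ | ⟨rfl, hl⟩ | ⟨rfl, hl⟩ | ⟨rfl, hl⟩⟩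
    · exact Or.inr (Or.inr ⟨1, 0, Reach.one, Or.inl ⟨by rw [one_mul, lift_one], by omega⟩⟩)
    · exact Or.inr (Or.inr ⟨1, 0, Reach.one,
        Or.inr (Or.inl ⟨by rw [lift_one], by omega⟩)⟩)
    · exact Or.inr (Or.inr ⟨_, _, hm.mul_s, Or.inl ⟨(lift_mul_s h).symm, by omega⟩⟩)
    · exact Or.inr (Or.inr ⟨_, _, hm.mul_s,
        Or.inr (Or.inl ⟨by rw [lift_mul_s, mul_assoc], by omega⟩)⟩)
    · exact Or.inr (Or.inr ⟨_, _, hm.mul_f, Or.inl ⟨(lift_mul_f h).symm, by omega⟩⟩)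
    · exact Or.inr (Or.inr ⟨_, _, hm.mul_f,
        Or.inr (Or.inl ⟨by rw [lift_mul_f]; simp only [mul_assoc], by omega⟩)⟩)

/-- The monoid generated by `s` and `f`, described by the wreath recursion. -/
inductive Gen : RightTransf ℤ → Prop
  | one : Gen 1
  | s : Gen s
  | lift {h : RightTransf ℤ} : Gen h → Gen (lift h)
  | s_lift {h : RightTransf ℤ} : Gen h → Gen (MealyGrowth.s * MealyGrowth.lift h)
  | lift_s {h : RightTransf ℤ} : Gen h → Gen (MealyGrowth.lift h * MealyGrowth.s)
  | s_lift_s {h : RightTransf ℤ} : Gen h →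
      Gen (MealyGrowth.s * MealyGrowth.lift h * MealyGrowth.s)

/-! ### Fixed points of left multiplication by `s f s f` and by `f f` -/

/-- The fixed points of left multiplication by `s f s f`. -/
def FixSF (g : RightTransf ℤ) : Prop := s * (f * (s * (f * g))) = g

/-- The fixed points of left multiplication by `f f`. -/
def FixFF (g : RightTransf ℤ) : Prop := f * (f * g) = g

theorem fixSF_mul_s {g : RightTransf ℤ} : FixSF (g * s) ↔ FixSF g := by
  unfold FixSF; simp only [← mul_assoc]; exact mul_s_inj

theorem fixFF_mul_s {g : RightTransf ℤ} : FixFF (g * s) ↔ FixFF g := by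
  unfold FixFF; simp only [← mul_assoc]; exact mul_s_inj

theorem f_s_mul_ne {h : RightTransf ℤ} (hg : Gen h) : f * (s * h) ≠ s * (f * h) := by
  have h0 : f * s ≠ s * f := by
    rw [← lift_one]
    exact (((oddValued_lift 1).mul_left s).ne_mul_s (oddValued_lift 1)).symm
  have hl : ∀ v, f * (s * v) ≠ s * (f * v) → f * (s * lift v) ≠ s * (f * lift v) := by
    intro v hv e
    rw [f_mul_s_mul_lift, f_mul_lift, lift_eq_s_mul_lift] at e
    exact hv (by rw [← s_mul_inj, ← e.1, s_mul_cancel])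
  have hsl : ∀ v, f * (s * v) ≠ s * (f * v) →
      f * (s * (s * lift v)) ≠ s * (f * (s * lift v)) := by
    intro v hv e
    rw [f_mul_s_mul_lift, s_mul_cancel, f_mul_lift, lift_eq_s_mul_lift] at e
    exact hv (by rw [← s_mul_inj, ← e.2, s_mul_cancel])
  have hr : ∀ v, f * (s * v) ≠ s * (f * v) → f * (s * (v * s)) ≠ s * (f * (v * s)) := by
    intro v hv e
    simp only [← mul_assoc, mul_s_inj] at e hv
    exact hv e
  induction hg with
  | one => simpa using h0
  | s => simpa using hr 1 (by simpa using h0)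
  | lift _ ih => exact hl _ ih
  | s_lift _ ih => exact hsl _ ih
  | lift_s _ ih => exact hr _ (hl _ ih)
  | s_lift_s _ ih => exact hr _ (hsl _ ih)

theorem not_fixSF_lift {h : RightTransf ℤ} (hg : Gen h) : ¬ FixSF (lift h) := by
  intro e
  rw [FixSF, f_mul_lift, f_mul_s_mul_lift, eq_comm, lift_eq_s_mul_lift] at e
  exact f_s_mul_ne hg e.2

theorem fixSF_s_mul_lift {h : RightTransf ℤ} : FixSF (s * lift h) ↔ FixFF h := by
  rw [FixSF, f_mul_s_mul_lift, f_mul_s_mul_lift, s_mul_inj, lift_inj, FixFF]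

theorem fixFF_lift (h : RightTransf ℤ) : FixFF (lift h) := by
  rw [FixFF, f_mul_lift, f_mul_lift, s_mul_cancel]

theorem fixFF_s_mul_lift {h : RightTransf ℤ} : FixFF (s * lift h) ↔ FixSF h := by
  rw [FixFF, f_mul_s_mul_lift, f_mul_lift, lift_eq_s_mul_lift, FixSF]
  exact ⟨fun e => e.2.symm, fun e => ⟨rfl, e.symm⟩⟩

theorem not_fixSF_one : ¬ FixSF 1 := by
  intro e
  rw [FixSF, mul_one] at e
  nth_rw 2 [← lift_one] at e
  exact ((((oddValued_lift 1).mul_left s).mul_left f).mul_left s).ne_one e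

theorem not_fixFF_one : ¬ FixFF 1 := by
  intro e
  rw [FixFF, mul_one, ← lift_one] at e
  exact ((oddValued_lift 1).mul_left _).ne_one e

theorem not_fixSF_s : ¬ FixSF s := by
  rw [← one_mul s, fixSF_mul_s]; exact not_fixSF_one

theorem not_fixFF_s : ¬ FixFF s := by
  rw [← one_mul s, fixFF_mul_s]; exact not_fixFF_one

theorem FixSF.not_fixFF {g : RightTransf ℤ} (hg : Gen g) (h : FixSF g) : ¬ FixFF g := by
  have key : ∀ v, (FixSF v → ¬ FixFF v) → FixSF (s * MealyGrowth.lift v) →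
      ¬ FixFF (s * MealyGrowth.lift v) := by
    intro v hv h1 h2
    exact hv (fixFF_s_mul_lift.1 h2) (fixSF_s_mul_lift.1 h1)
  induction hg with
  | one => exact absurd h not_fixSF_one
  | s => exact absurd h not_fixSF_s
  | lift hv => exact absurd h (not_fixSF_lift hv)
  | s_lift _ ih => exact key _ ih h
  | lift_s hv => exact absurd (fixSF_mul_s.1 h) (not_fixSF_lift hv)
  | s_lift_s _ ih => exact fun h2 => key _ ih (fixSF_mul_s.1 h) (fixFF_mul_s.1 h2)

theorem FixSF.lift_eq {h : RightTransf ℤ} (hh : FixSF h) :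
    MealyGrowth.lift h = s * MealyGrowth.lift (s * (f * h)) :=
  lift_eq_s_mul_lift.2 ⟨hh.symm, rfl⟩

theorem FixSF.s_mul_lift_eq {h : RightTransf ℤ} (hh : FixSF h) :
    s * MealyGrowth.lift h = MealyGrowth.lift (s * (f * h)) :=
  (lift_eq_s_mul_lift.2 ⟨rfl, hh.symm⟩).symm

theorem fixSF_of_lift_eq {h k : RightTransf ℤ} (e : lift h = s * lift k) : FixSF h ∧ FixSF k := by
  obtain ⟨e1, e2⟩ := lift_eq_s_mul_lift.1 e
  exact ⟨by rw [FixSF, ← e2, ← e1], by rw [FixSF, ← e1, ← e2]⟩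

theorem FixSF.s_f_mul {h : RightTransf ℤ} (hh : FixSF h) : FixSF (s * (f * h)) :=
  (fixSF_of_lift_eq hh.lift_eq).2

/-! ### Finite sets of elements with bounded depth -/

section Step

open scoped Classical

/-- The elements with odd image whose section lies in `Y`. -/
noncomputable def stepOdd (Y : Finset (RightTransf ℤ)) : Finset (RightTransf ℤ) :=
  Y.image lift ∪ Y.image fun h => s * lift h

/-- The elements `1`, `s`, and those whose section lies in `Y`. -/
noncomputable def step (Y : Finset (RightTransf ℤ)) : Finset (RightTransf ℤ) :=
  {1, s} ∪ (stepOdd Y ∪ (stepOdd Y).image (· * s))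

/-- The number of elements of `Y` not fixed by `s f s f`. -/
noncomputable def cardSF (Y : Finset (RightTransf ℤ)) : ℕ := (Y.filter fun g => ¬ FixSF g).card

/-- The number of elements of `Y` not fixed by `f f`. -/
noncomputable def cardFF (Y : Finset (RightTransf ℤ)) : ℕ := (Y.filter fun g => ¬ FixFF g).card

theorem mem_stepOdd {Y : Finset (RightTransf ℤ)} {g : RightTransf ℤ} :
    g ∈ stepOdd Y ↔ ∃ h ∈ Y, g = lift h ∨ g = s * lift h := by
  simp only [stepOdd, Finset.mem_union, Finset.mem_image]
  constructor
  · rintro (⟨h, hh, rfl⟩ | ⟨h, hh, rfl⟩)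
    exacts [⟨h, hh, Or.inl rfl⟩, ⟨h, hh, Or.inr rfl⟩]
  · rintro ⟨h, hh, rfl | rfl⟩
    exacts [Or.inl ⟨h, hh, rfl⟩, Or.inr ⟨h, hh, rfl⟩]

theorem mem_step {Y : Finset (RightTransf ℤ)} {g : RightTransf ℤ} :
    g ∈ step Y ↔ g = 1 ∨ g = s ∨ g ∈ stepOdd Y ∨ ∃ k ∈ stepOdd Y, g = k * s := by
  simp only [step, Finset.mem_union, Finset.mem_insert, Finset.mem_singleton, Finset.mem_image,
    or_assoc, eq_comm]

theorem oddValued_of_mem_stepOdd {Y : Finset (RightTransf ℤ)} {g : RightTransf ℤ}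
    (hg : g ∈ stepOdd Y) : OddValued g := by
  obtain ⟨h, -, rfl | rfl⟩ := mem_stepOdd.1 hg
  exacts [oddValued_lift h, (oddValued_lift h).mul_left s]

theorem card_filter_step (R : RightTransf ℤ → Prop) (hR : ∀ g, R (g * s) ↔ R g) (h1 : ¬ R 1)
    (Y : Finset (RightTransf ℤ)) :
    ((step Y).filter fun g => ¬ R g).card = 2 + 2 * ((stepOdd Y).filter fun g => ¬ R g).card := by
  have hs : ¬ R s := by rw [← one_mul s, hR]; exact h1
  have e : (step Y).filter (fun g => ¬ R g) = {1, s} ∪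
      ((stepOdd Y).filter (fun g => ¬ R g) ∪
        ((stepOdd Y).filter fun g => ¬ R g).image (· * s)) := by
    ext g
    simp only [step, Finset.mem_filter, Finset.mem_union, Finset.mem_insert,
      Finset.mem_singleton, Finset.mem_image]
    constructor
    · rintro ⟨(rfl | rfl) | h | ⟨k, hk, rfl⟩, hg⟩
      · exact Or.inl (Or.inl rfl)
      · exact Or.inl (Or.inr rfl)
      · exact Or.inr (Or.inl ⟨h, hg⟩)
      · exact Or.inr (Or.inr ⟨k, ⟨hk, fun hh => hg ((hR k).2 hh)⟩, rfl⟩)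
    · rintro ((rfl | rfl) | ⟨h, hg⟩ | ⟨k, ⟨hk, hg⟩, rfl⟩)
      · exact ⟨Or.inl (Or.inl rfl), h1⟩
      · exact ⟨Or.inl (Or.inr rfl), hs⟩
      · exact ⟨Or.inr (Or.inl h), hg⟩
      · exact ⟨Or.inr (Or.inr ⟨k, hk, rfl⟩), fun hh => hg ((hR k).1 hh)⟩
  have h1s : (1 : RightTransf ℤ) ≠ s := by
    intro hh
    have := congrArg (fun g : RightTransf ℤ => g.unop (2 * 0)) hh
    simp only [one_apply, s_apply, sMap_even] at this
    omega
  rw [e, Finset.card_union_of_disjoint, Finset.card_union_of_disjoint,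
    Finset.card_image_of_injective _ (fun g h => mul_s_inj.1), Finset.card_pair h1s]
  · ring
  · rw [Finset.disjoint_left]
    intro g hg hg'
    obtain ⟨k, hk, rfl⟩ := Finset.mem_image.1 hg'
    exact (oddValued_of_mem_stepOdd (Finset.mem_filter.1 hg).1).ne_mul_s
      (oddValued_of_mem_stepOdd (Finset.mem_filter.1 hk).1) rfl
  · rw [Finset.disjoint_left]
    intro g hg hg'
    rw [Finset.mem_insert, Finset.mem_singleton] at hg
    rcases Finset.mem_union.1 hg' with hk | hk
    · have hk := oddValued_of_mem_stepOdd (Finset.mem_filter.1 hk).1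
      rcases hg with rfl | rfl
      exacts [hk.ne_one rfl, hk.ne_s rfl]
    · obtain ⟨k, hk', rfl⟩ := Finset.mem_image.1 hk
      have hk := oddValued_of_mem_stepOdd (Finset.mem_filter.1 hk').1
      rcases hg with hg | hg
      · exact hk.ne_s (by rw [← mul_s_cancel k, hg, one_mul])
      · exact hk.ne_one (by rw [← mul_s_inj, hg, one_mul])

theorem card_step (Y : Finset (RightTransf ℤ)) : (step Y).card = 2 + 2 * (stepOdd Y).card := by
  simpa using card_filter_step (fun _ => False) (fun _ => Iff.rfl) id Y

theorem cardSF_step (Y : Finset (RightTransf ℤ)) : cardSF (step Y) = 2 + 2 * cardSF (stepOdd Y) :=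
  card_filter_step FixSF (fun _ => fixSF_mul_s) not_fixSF_one Y

theorem cardFF_step (Y : Finset (RightTransf ℤ)) : cardFF (step Y) = 2 + 2 * cardFF (stepOdd Y) :=
  card_filter_step FixFF (fun _ => fixFF_mul_s) not_fixFF_one Y

theorem card_image_lift (Y : Finset (RightTransf ℤ)) : (Y.image lift).card = Y.card :=
  Finset.card_image_of_injective _ lift_injective

theorem card_image_s_mul_lift (Y : Finset (RightTransf ℤ)) :
    (Y.image fun h => s * lift h).card = Y.card :=
  Finset.card_image_of_injective _ fun _ _ e => lift_injective (s_mul_inj.1 e)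

/-- All elements of `Y` belong to the semigroup. -/
def GenSet (Y : Finset (RightTransf ℤ)) : Prop := ∀ g ∈ Y, Gen g

theorem GenSet.step {Y : Finset (RightTransf ℤ)} (hY : GenSet Y) :
    GenSet (MealyGrowth.step Y) := by
  intro g hg
  rcases mem_step.1 hg with rfl | rfl | hk | ⟨k, hk, rfl⟩
  · exact .one
  · exact .s
  · obtain ⟨h, hh, rfl | rfl⟩ := mem_stepOdd.1 hk
    exacts [(hY h hh).lift, (hY h hh).s_lift]
  · obtain ⟨h, hh, rfl | rfl⟩ := mem_stepOdd.1 hk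
    exacts [(hY h hh).lift_s, (hY h hh).s_lift_s]

theorem le_card_step (Y : Finset (RightTransf ℤ)) :
    2 + 2 * (Y.card + cardSF Y) ≤ (step Y).card := by
  have hd : Disjoint (Y.image fun h => s * lift h)
      ((Y.filter fun g => ¬ FixSF g).image lift) := by
    rw [Finset.disjoint_left]
    intro g hg hg'
    obtain ⟨h, hh, rfl⟩ := Finset.mem_image.1 hg
    obtain ⟨k, hk, e⟩ := Finset.mem_image.1 hg'
    exact (Finset.mem_filter.1 hk).2 (fixSF_of_lift_eq e).1
  have hle : Y.card + cardSF Y ≤ (stepOdd Y).card := by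
    rw [cardSF, ← card_image_s_mul_lift Y, ← card_image_lift (Y.filter _),
      ← Finset.card_union_of_disjoint hd]
    refine Finset.card_le_card (Finset.union_subset Finset.subset_union_right ?_)
    exact (Finset.image_subset_image (Finset.filter_subset _ _)).trans Finset.subset_union_left
  rw [card_step]; omega

theorem le_cardSF_step {Y : Finset (RightTransf ℤ)} (hY : GenSet Y) :
    2 + 2 * (cardSF Y + cardFF Y) ≤ cardSF (step Y) := by
  have hd : Disjoint ((Y.filter fun g => ¬ FixSF g).image lift)
      ((Y.filter fun g => ¬ FixFF g).image fun h => s * lift h) := by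
    rw [Finset.disjoint_left]
    intro g hg hg'
    obtain ⟨h, hh, rfl⟩ := Finset.mem_image.1 hg
    obtain ⟨k, hk, e⟩ := Finset.mem_image.1 hg'
    exact (Finset.mem_filter.1 hh).2 (fixSF_of_lift_eq e.symm).1
  have hle : cardSF Y + cardFF Y ≤ cardSF (stepOdd Y) := by
    rw [cardSF, cardFF, cardSF, ← card_image_lift (Y.filter fun g => ¬ FixSF g),
      ← card_image_s_mul_lift (Y.filter fun g => ¬ FixFF g), ← Finset.card_union_of_disjoint hd]
    refine Finset.card_le_card (Finset.union_subset ?_ ?_)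
    · intro g hg
      obtain ⟨h, hh, rfl⟩ := Finset.mem_image.1 hg
      have hh := (Finset.mem_filter.1 hh).1
      exact Finset.mem_filter.2 ⟨mem_stepOdd.2 ⟨h, hh, Or.inl rfl⟩, not_fixSF_lift (hY h hh)⟩
    · intro g hg
      obtain ⟨h, hh, rfl⟩ := Finset.mem_image.1 hg
      obtain ⟨hh, hf⟩ := Finset.mem_filter.1 hh
      exact Finset.mem_filter.2 ⟨mem_stepOdd.2 ⟨h, hh, Or.inr rfl⟩,
        fun hk => hf (fixSF_s_mul_lift.1 hk)⟩
  rw [cardSF_step]; omega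

theorem le_cardFF_step (Y : Finset (RightTransf ℤ)) :
    2 + 2 * cardSF Y ≤ cardFF (step Y) := by
  have hle : cardSF Y ≤ cardFF (stepOdd Y) := by
    rw [cardSF, cardFF, ← card_image_s_mul_lift (Y.filter _)]
    refine Finset.card_le_card fun g hg => ?_
    obtain ⟨h, hh, rfl⟩ := Finset.mem_image.1 hg
    obtain ⟨hh, hf⟩ := Finset.mem_filter.1 hh
    exact Finset.mem_filter.2 ⟨mem_stepOdd.2 ⟨h, hh, Or.inr rfl⟩,
      fun hk => hf (fixFF_s_mul_lift.1 hk)⟩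
  rw [cardFF_step]; omega

/-- Closure properties which make the lower bounds for the cardinality of `step Y` sharp. -/
structure Closed (Y : Finset (RightTransf ℤ)) : Prop where
  gen : GenSet Y
  s_mul : ∀ g ∈ Y, s * g ∈ Y
  f_mul : ∀ g ∈ Y, FixFF g → f * g ∈ Y
  s_f_mul : ∀ g ∈ Y, FixSF g → s * (f * g) ∈ Y

theorem Closed.stepOdd_mul {Y : Finset (RightTransf ℤ)} (hY : Closed Y)
    {g : RightTransf ℤ} (hg : g ∈ stepOdd Y) :
    s * g ∈ stepOdd Y ∧ (FixFF g → f * g ∈ stepOdd Y) ∧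
      (FixSF g → s * (f * g) ∈ stepOdd Y) := by
  obtain ⟨h, hh, rfl | rfl⟩ := mem_stepOdd.1 hg
  · refine ⟨mem_stepOdd.2 ⟨h, hh, Or.inr rfl⟩, fun _ => ?_,
      fun hk => absurd hk (not_fixSF_lift (hY.gen h hh))⟩
    exact mem_stepOdd.2 ⟨s * h, hY.s_mul h hh, Or.inl (f_mul_lift h)⟩
  · refine ⟨mem_stepOdd.2 ⟨h, hh, Or.inl (s_mul_cancel _)⟩, fun hk => ?_, fun hk => ?_⟩
    · have h1 := hY.s_mul _ (hY.s_f_mul h hh (fixFF_s_mul_lift.1 hk))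
      rw [s_mul_cancel] at h1
      exact mem_stepOdd.2 ⟨f * h, h1, Or.inl (f_mul_s_mul_lift h)⟩
    · refine mem_stepOdd.2 ⟨f * h, hY.f_mul h hh (fixSF_s_mul_lift.1 hk), Or.inr ?_⟩
      rw [f_mul_s_mul_lift]

theorem Closed.step {Y : Finset (RightTransf ℤ)} (hY : Closed Y) :
    Closed (MealyGrowth.step Y) := by
  have hodd := fun g => hY.stepOdd_mul (g := g)
  refine ⟨hY.gen.step, fun g hg => ?_, fun g hg hk => ?_, fun g hg hk => ?_⟩ <;>
    rcases mem_step.1 hg with rfl | rfl | h | ⟨k, h, rfl⟩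
  · exact mem_step.2 (Or.inr (Or.inl (mul_one _)))
  · exact mem_step.2 (Or.inl s_mul_s)
  · exact mem_step.2 (Or.inr (Or.inr (Or.inl (hodd g h).1)))
  · exact mem_step.2 (Or.inr (Or.inr (Or.inr ⟨_, (hodd k h).1, (mul_assoc _ _ _).symm⟩)))
  · exact absurd hk not_fixFF_one
  · exact absurd hk not_fixFF_s
  · exact mem_step.2 (Or.inr (Or.inr (Or.inl ((hodd g h).2.1 hk))))
  · exact mem_step.2 (Or.inr (Or.inr (Or.inr
      ⟨_, (hodd k h).2.1 (fixFF_mul_s.1 hk), (mul_assoc _ _ _).symm⟩)))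
  · exact absurd hk not_fixSF_one
  · exact absurd hk not_fixSF_s
  · exact mem_step.2 (Or.inr (Or.inr (Or.inl ((hodd g h).2.2 hk))))
  · exact mem_step.2 (Or.inr (Or.inr (Or.inr
      ⟨_, (hodd k h).2.2 (fixSF_mul_s.1 hk), by simp only [mul_assoc]⟩)))

theorem Closed.card_step_le {Y : Finset (RightTransf ℤ)} (hY : Closed Y) :
    (MealyGrowth.step Y).card ≤ 2 + 2 * (Y.card + cardSF Y) := by
  have hsub : stepOdd Y ⊆ Y.image lift ∪
      (Y.filter fun g => ¬ FixSF g).image fun h => s * lift h := by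
    intro g hg
    obtain ⟨h, hh, rfl | rfl⟩ := mem_stepOdd.1 hg
    · exact Finset.mem_union_left _ (Finset.mem_image_of_mem _ hh)
    · by_cases hk : FixSF h
      · rw [hk.s_mul_lift_eq]
        exact Finset.mem_union_left _ (Finset.mem_image_of_mem _ (hY.s_f_mul h hh hk))
      · exact Finset.mem_union_right _
          (Finset.mem_image_of_mem (fun h => s * lift h) (Finset.mem_filter.2 ⟨hh, hk⟩))
  have hle := (Finset.card_le_card hsub).trans (Finset.card_union_le _ _)
  rw [card_image_lift, card_image_s_mul_lift] at hle
  rw [card_step, cardSF]; omega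

theorem Closed.cardSF_step_le {Y : Finset (RightTransf ℤ)} (hY : Closed Y) :
    cardSF (MealyGrowth.step Y) ≤ 2 + 2 * (cardSF Y + cardFF Y) := by
  have hsub : (stepOdd Y).filter (fun g => ¬ FixSF g) ⊆
      (Y.filter fun g => ¬ FixSF g).image lift ∪
      (Y.filter fun g => ¬ FixFF g).image fun h => s * lift h := by
    intro g hg
    obtain ⟨hg, hg'⟩ := Finset.mem_filter.1 hg
    obtain ⟨h, hh, rfl | rfl⟩ := mem_stepOdd.1 hg
    · by_cases hk : FixSF h
      · have hm := hY.s_f_mul h hh hk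
        rw [hk.lift_eq]
        exact Finset.mem_union_right _ (Finset.mem_image_of_mem (fun h => s * lift h)
          (Finset.mem_filter.2 ⟨hm, hk.s_f_mul.not_fixFF (hY.gen _ hm)⟩))
      · exact Finset.mem_union_left _
          (Finset.mem_image_of_mem _ (Finset.mem_filter.2 ⟨hh, hk⟩))
    · exact Finset.mem_union_right _ (Finset.mem_image_of_mem (fun h => s * lift h)
        (Finset.mem_filter.2 ⟨hh, fun hk => hg' (fixSF_s_mul_lift.2 hk)⟩))
  have hle := (Finset.card_le_card hsub).trans (Finset.card_union_le _ _)
  rw [card_image_lift, card_image_s_mul_lift] at hle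
  rw [cardSF_step]; exact Nat.add_le_add_left (Nat.mul_le_mul_left 2 hle) 2

theorem cardFF_step_le (Y : Finset (RightTransf ℤ)) :
    cardFF (MealyGrowth.step Y) ≤ 2 + 2 * cardSF Y := by
  have hsub : (stepOdd Y).filter (fun g => ¬ FixFF g) ⊆
      (Y.filter fun g => ¬ FixSF g).image fun h => s * lift h := by
    intro g hg
    obtain ⟨hg, hg'⟩ := Finset.mem_filter.1 hg
    obtain ⟨h, hh, rfl | rfl⟩ := mem_stepOdd.1 hg
    · exact absurd (fixFF_lift h) hg'
    · exact Finset.mem_image_of_mem (fun h => s * lift h)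
        (Finset.mem_filter.2 ⟨hh, fun hk => hg' (fixFF_s_mul_lift.2 hk)⟩)
  have hle := Finset.card_le_card hsub
  rw [card_image_s_mul_lift] at hle
  rw [cardFF_step]; exact Nat.add_le_add_left (Nat.mul_le_mul_left 2 hle) 2

end Step

section Levels

open scoped Classical

/-! ### Iterated steps and Fibonacci weights -/

/-- The cardinalities of `Y`, and of the sets of elements of `Y` not fixed by `s f s f` and by
`f f`, evolve under `step` like this sequence. -/
def count (v : ℕ × ℕ × ℕ) : ℕ → ℕ × ℕ × ℕ
  | 0 => v
  | d + 1 => (2 + 2 * ((count v d).1 + (count v d).2.1),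
      2 + 2 * ((count v d).2.1 + (count v d).2.2), 2 + 2 * (count v d).2.1)

theorem GenSet.iterate_step {Y : Finset (RightTransf ℤ)} (hY : GenSet Y) (d : ℕ) :
    GenSet (MealyGrowth.step^[d] Y) := by
  induction d with
  | zero => exact hY
  | succ d ih => rw [Function.iterate_succ_apply']; exact ih.step

theorem Closed.iterate_step {Y : Finset (RightTransf ℤ)} (hY : Closed Y) (d : ℕ) :
    Closed (MealyGrowth.step^[d] Y) := by
  induction d with
  | zero => exact hY
  | succ d ih => rw [Function.iterate_succ_apply']; exact ih.step

theorem GenSet.count_le {Y : Finset (RightTransf ℤ)} (hY : GenSet Y) {v : ℕ × ℕ × ℕ}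
    (h1 : v.1 ≤ Y.card) (h2 : v.2.1 ≤ cardSF Y) (h3 : v.2.2 ≤ cardFF Y) (d : ℕ) :
    (count v d).1 ≤ (MealyGrowth.step^[d] Y).card ∧
      (count v d).2.1 ≤ cardSF (MealyGrowth.step^[d] Y) ∧
      (count v d).2.2 ≤ cardFF (MealyGrowth.step^[d] Y) := by
  induction d with
  | zero => exact ⟨h1, h2, h3⟩
  | succ d ih =>
    rw [Function.iterate_succ_apply']
    have e1 := le_card_step (MealyGrowth.step^[d] Y)
    have e2 := le_cardSF_step (hY.iterate_step d)
    have e3 := le_cardFF_step (MealyGrowth.step^[d] Y)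
    simp only [count]
    omega

theorem Closed.le_count {Y : Finset (RightTransf ℤ)} (hY : Closed Y) {v : ℕ × ℕ × ℕ}
    (h1 : Y.card ≤ v.1) (h2 : cardSF Y ≤ v.2.1) (h3 : cardFF Y ≤ v.2.2) (d : ℕ) :
    (MealyGrowth.step^[d] Y).card ≤ (count v d).1 ∧
      cardSF (MealyGrowth.step^[d] Y) ≤ (count v d).2.1 ∧
      cardFF (MealyGrowth.step^[d] Y) ≤ (count v d).2.2 := by
  induction d with
  | zero => exact ⟨h1, h2, h3⟩
  | succ d ih =>
    rw [Function.iterate_succ_apply']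
    have e1 := (hY.iterate_step d).card_step_le
    have e2 := (hY.iterate_step d).cardSF_step_le
    have e3 := cardFF_step_le (MealyGrowth.step^[d] Y)
    simp only [count]
    omega

theorem cardSF_le_card (Y : Finset (RightTransf ℤ)) : cardSF Y ≤ Y.card :=
  Finset.card_filter_le _ _

theorem cardFF_le_card (Y : Finset (RightTransf ℤ)) : cardFF Y ≤ Y.card :=
  Finset.card_filter_le _ _

theorem step_empty : step ∅ = {1, s} := by simp [step, stepOdd]

theorem closed_empty : Closed ∅ := by
  constructor <;> simp [GenSet]

theorem closed_pair : Closed {1, s} := step_empty ▸ closed_empty.step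

/-- The set `{1, s, f, s f, f f, s f f}`. -/
noncomputable def sixSet : Finset (RightTransf ℤ) := {1, s} ∪ stepOdd {1, s}

theorem mem_sixSet {g : RightTransf ℤ} : g ∈ sixSet ↔ g = 1 ∨ g = s ∨ g ∈ stepOdd {1, s} := by
  simp [sixSet]

theorem closed_sixSet : Closed sixSet := by
  have hodd := fun g => closed_pair.stepOdd_mul (g := g)
  refine ⟨fun g hg => ?_, fun g hg => ?_, fun g hg hk => ?_, fun g hg hk => ?_⟩ <;>
    rcases mem_sixSet.1 hg with rfl | rfl | h
  · exact .one
  · exact .s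
  · exact closed_pair.step.gen g (mem_step.2 (Or.inr (Or.inr (Or.inl h))))
  · exact mem_sixSet.2 (Or.inr (Or.inl (mul_one _)))
  · exact mem_sixSet.2 (Or.inl s_mul_s)
  · exact mem_sixSet.2 (Or.inr (Or.inr (hodd g h).1))
  · exact absurd hk not_fixFF_one
  · exact absurd hk not_fixFF_s
  · exact mem_sixSet.2 (Or.inr (Or.inr ((hodd g h).2.1 hk)))
  · exact absurd hk not_fixSF_one
  · exact absurd hk not_fixSF_s
  · exact mem_sixSet.2 (Or.inr (Or.inr ((hodd g h).2.2 hk)))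

theorem card_sixSet_le : sixSet.card ≤ 6 := by
  have h1 : ({1, s} : Finset (RightTransf ℤ)).card ≤ 2 := Finset.card_le_two
  have h2 := Finset.card_union_le ({1, s} : Finset (RightTransf ℤ)) (stepOdd {1, s})
  have h3 : (stepOdd {1, s}).card ≤ _ := Finset.card_union_le _ _
  rw [card_image_lift, card_image_s_mul_lift] at h3
  rw [sixSet]; omega

theorem cardFF_sixSet_le : cardFF sixSet ≤ 4 := by
  have hsub : sixSet.filter (fun g => ¬ FixFF g) ⊆ {1, s, s * lift 1, s * lift s} := by
    intro g hg
    obtain ⟨hg, hk⟩ := Finset.mem_filter.1 hg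
    simp only [Finset.mem_insert, Finset.mem_singleton]
    rcases mem_sixSet.1 hg with rfl | rfl | hs
    · exact Or.inl rfl
    · exact Or.inr (Or.inl rfl)
    · obtain ⟨h, hh, rfl | rfl⟩ := mem_stepOdd.1 hs
      · exact absurd (fixFF_lift h) hk
      · simp only [Finset.mem_insert, Finset.mem_singleton] at hh
        rcases hh with rfl | rfl
        · exact Or.inr (Or.inr (Or.inl rfl))
        · exact Or.inr (Or.inr (Or.inr rfl))
  exact (Finset.card_le_card hsub).trans Finset.card_le_four

theorem Reach.mem_step {a b ℓ : ℕ} {Y : Finset (RightTransf ℤ)}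
    (hY : ∀ m h, Reach b (a + b) m h → m + b ≤ ℓ → h ∈ Y) {g : RightTransf ℤ}
    (hr : Reach a b ℓ g) : g ∈ step Y := by
  rw [MealyGrowth.mem_step]
  rcases hr.cases_lift with rfl | ⟨rfl, -⟩ | ⟨h, m, hm, hc⟩
  · exact Or.inl rfl
  · exact Or.inr (Or.inl rfl)
  · have hh : h ∈ Y := hY m h hm (by omega)
    rcases hc with ⟨rfl, -⟩ | ⟨rfl, -⟩ | ⟨rfl, -⟩ | ⟨rfl, -⟩
    · exact Or.inr (Or.inr (Or.inl (mem_stepOdd.2 ⟨h, hh, Or.inl rfl⟩)))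
    · exact Or.inr (Or.inr (Or.inl (mem_stepOdd.2 ⟨h, hh, Or.inr rfl⟩)))
    · exact Or.inr (Or.inr (Or.inr ⟨_, mem_stepOdd.2 ⟨h, hh, Or.inl rfl⟩, rfl⟩))
    · exact Or.inr (Or.inr (Or.inr ⟨_, mem_stepOdd.2 ⟨h, hh, Or.inr rfl⟩, rfl⟩))

theorem Reach.mem_iterate_step_pair {d n ℓ : ℕ} {g : RightTransf ℤ}
    (hr : Reach (n + 1).fib (n + 2).fib ℓ g) (hl : ℓ + (n + 3).fib < (n + d + 4).fib) :
    g ∈ step^[d] {1, s} := by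
  have e3 : (n + 3).fib = (n + 1).fib + (n + 2).fib := Nat.fib_add_two
  have e4 : (n + 4).fib = (n + 2).fib + (n + 3).fib := Nat.fib_add_two
  induction d generalizing n ℓ g with
  | zero =>
    rw [Function.iterate_zero_apply, ← step_empty]
    exact hr.mem_step fun m h _ hm => by simp only [add_zero] at hl; omega
  | succ d ih =>
    rw [Function.iterate_succ_apply']
    refine hr.mem_step fun m h hh hm => ih (n := n + 1) (ℓ := m) (e3 ▸ hh) ?_ e4 Nat.fib_add_two
    rw [show n + 1 + d + 4 = n + (d + 1) + 4 by ring, show n + 1 + 3 = n + 4 by ring]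
    omega

theorem Reach.mem_iterate_step_sixSet {d n ℓ : ℕ} {g : RightTransf ℤ}
    (hr : Reach (n + 1).fib (n + 2).fib ℓ g) (hl : ℓ + (n + 3).fib < 2 * (n + d + 3).fib) :
    g ∈ step^[d] sixSet := by
  have e3 : (n + 3).fib = (n + 1).fib + (n + 2).fib := Nat.fib_add_two
  have e4 : (n + 4).fib = (n + 2).fib + (n + 3).fib := Nat.fib_add_two
  induction d generalizing n ℓ g with
  | zero =>
    rw [Function.iterate_zero_apply, mem_sixSet]
    simp only [add_zero] at hl
    have hmono : (n + 1).fib ≤ (n + 2).fib := Nat.fib_le_fib_succ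
    rcases hr.cases_lift with rfl | ⟨rfl, -⟩ | ⟨h, m, hm, hc⟩
    · exact Or.inl rfl
    · exact Or.inr (Or.inl rfl)
    · have h1 : h = 1 := by
        rcases hm.cases_lift with rfl | ⟨rfl, _⟩ | ⟨k, j, _, _⟩
        · rfl
        · omega
        · omega
      rcases hc with ⟨rfl, -⟩ | ⟨rfl, _⟩ | ⟨rfl, _⟩ | ⟨rfl, _⟩
      · exact Or.inr (Or.inr (mem_stepOdd.2 ⟨h, by simp [h1], Or.inl rfl⟩))
      all_goals omega
  | succ d ih =>
    rw [Function.iterate_succ_apply']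
    refine hr.mem_step fun m h hh hm => ih (n := n + 1) (ℓ := m) (e3 ▸ hh) ?_ e4 Nat.fib_add_two
    rw [show n + 1 + d + 3 = n + (d + 1) + 3 by ring, show n + 1 + 3 = n + 4 by ring]
    omega

/-- Every element of `Y` is a product of generators of weight at most `x`, for the weights of
level `n`. -/
def Within (n x : ℕ) (Y : Finset (RightTransf ℤ)) : Prop :=
  ∀ g ∈ Y, ∃ ℓ ≤ x, Reach (n + 1).fib (n + 2).fib ℓ g

theorem Within.step {n x : ℕ} {Y : Finset (RightTransf ℤ)} (hY : Within (n + 1) x Y) :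
    Within n (x + (n + 1).fib + (n + 3).fib) (MealyGrowth.step Y) := by
  have e3 : (n + 3).fib = (n + 1).fib + (n + 2).fib := Nat.fib_add_two
  intro g hg
  rcases mem_step.1 hg with rfl | rfl | hk | ⟨k, hk, rfl⟩
  · exact ⟨0, by omega, .one⟩
  · exact ⟨0 + (n + 1).fib, by omega, by simpa using Reach.one.mul_s⟩
  all_goals
    obtain ⟨h, hh, rfl | rfl⟩ := mem_stepOdd.1 hk
    all_goals
      obtain ⟨m, hm, hr⟩ := hY h hh
      have hr : Reach (n + 1).fib (n + 2).fib (m + (n + 2).fib) (lift h) := Reach.lift (e3 ▸ hr)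
  · refine ⟨_, ?_, hr⟩; omega
  · refine ⟨_, ?_, hr.s_mul⟩; omega
  · refine ⟨_, ?_, hr.mul_s⟩; omega
  · refine ⟨_, ?_, hr.s_mul.mul_s⟩; omega

theorem Within.iterate_step {n d x y : ℕ} {Y : Finset (RightTransf ℤ)} (hY : Within (n + d) x Y)
    (hy : x + (n + d + 2).fib + (n + d + 4).fib ≤ y + (n + 2).fib + (n + 4).fib) :
    Within n y (MealyGrowth.step^[d] Y) := by
  have e3 : (n + 3).fib = (n + 1).fib + (n + 2).fib := Nat.fib_add_two
  have e4 : (n + 4).fib = (n + 2).fib + (n + 3).fib := Nat.fib_add_two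
  have e5 : (n + 5).fib = (n + 3).fib + (n + 4).fib := Nat.fib_add_two
  induction d generalizing n y with
  | zero =>
    intro g hg
    obtain ⟨m, hm, hr⟩ := hY g hg
    simp only [add_zero] at hy
    exact ⟨m, by omega, hr⟩
  | succ d ih =>
    rw [Function.iterate_succ_apply']
    have h1 : (n + 3).fib ≤ (n + (d + 1) + 2).fib := Nat.fib_mono (by omega)
    have h2 : (n + 5).fib ≤ (n + (d + 1) + 4).fib := Nat.fib_mono (by omega)
    have := (ih (n := n + 1) (y := y - (n + 1).fib - (n + 3).fib)
      (by rw [show n + 1 + d = n + (d + 1) by ring]; exact hY)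
      (by
        rw [show n + 1 + d = n + (d + 1) by ring, show n + 1 + 4 = n + 5 by ring,
          show n + 1 + 2 = n + 3 by ring]
        omega) e4 e5 Nat.fib_add_two).step
    intro g hg
    obtain ⟨m, hm, hr⟩ := this g hg
    exact ⟨m, by omega, hr⟩

end Levels

/-! ### Growth and change of generators -/

section Growth

variable {M : Type*} [Monoid M] {Q Q' : Set M}

theorem exists_word {g : M} (hg : g ∈ Subsemigroup.closure Q) :
    ∃ w : List M, (∀ q ∈ w, q ∈ Q) ∧ w.prod = g := by
  induction hg using Subsemigroup.closure_induction with
  | mem x hx => exact ⟨[x], by simpa using hx, by simp⟩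
  | mul x y _ _ hx hy =>
    obtain ⟨v, hv, rfl⟩ := hx
    obtain ⟨w, hw, rfl⟩ := hy
    exact ⟨v ++ w, fun q hq => (List.mem_append.1 hq).elim (hv q) (hw q), List.prod_append⟩

theorem wordNorm_le_iff {g : M} (hg : g ∈ Subsemigroup.closure Q) {ℓ : ℕ} :
    wordNorm Q g ≤ ℓ ↔ ∃ w : List M, w.length ≤ ℓ ∧ (∀ q ∈ w, q ∈ Q) ∧ w.prod = g := by
  constructor
  · intro h
    obtain ⟨w, hw, e⟩ := exists_word hg
    obtain ⟨v, hv, hvQ, hvg⟩ := Nat.sInf_mem (s := {ℓ : ℕ | ∃ w : List M, w.length = ℓ ∧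
      (∀ q ∈ w, q ∈ Q) ∧ w.prod = g}) ⟨w.length, w, rfl, hw, e⟩
    exact ⟨v, hv.trans_le h, hvQ, hvg⟩
  · rintro ⟨w, hw, hwQ, e⟩
    have : wordNorm Q g ≤ w.length := Nat.sInf_le ⟨w, rfl, hwQ, e⟩
    exact this.trans hw

/-- The ball of radius `ℓ` in the semigroup generated by `Q`. -/
def wordBall (Q : Set M) (ℓ : ℕ) : Set M :=
  {g : M | g ∈ Subsemigroup.closure Q ∧ wordNorm Q g ≤ ℓ}

open scoped Pointwise in
theorem finite_wordBall (hQ : Q.Finite) (ℓ : ℕ) : (wordBall Q ℓ).Finite := by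
  have hpow : ((insert 1 Q) ^ ℓ).Finite := by
    induction ℓ with
    | zero => rw [pow_zero]; exact Set.finite_one
    | succ ℓ ih => rw [pow_succ]; exact ih.mul (hQ.insert 1)
  refine hpow.subset ?_
  clear hpow
  rintro g ⟨hg, hl⟩
  obtain ⟨w, hw, hwQ, rfl⟩ := (wordNorm_le_iff hg).1 hl
  clear hg hl
  induction w generalizing ℓ with
  | nil => exact Set.one_mem_pow (Set.mem_insert _ _)
  | cons q w ih =>
    obtain ⟨ℓ, rfl⟩ : ∃ k, ℓ = k + 1 := ⟨ℓ - 1, by simp at hw; omega⟩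
    rw [pow_succ', List.prod_cons]
    exact Set.mul_mem_mul (Set.mem_insert_of_mem _ (hwQ q List.mem_cons_self))
      (ih ℓ (by simpa using hw) fun p hp => hwQ p (List.mem_cons_of_mem _ hp))

theorem exists_wordBall_subset (hQ : Q.Finite)
    (h : Subsemigroup.closure Q = Subsemigroup.closure Q') :
    ∃ c : ℕ, 0 < c ∧ ∀ ℓ, wordBall Q ℓ ⊆ wordBall Q' (c * ℓ) := by
  obtain ⟨c, hc⟩ := (hQ.image (wordNorm Q')).bddAbove
  refine ⟨c + 1, by omega, fun ℓ g hg => ?_⟩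
  obtain ⟨hg, hl⟩ := hg
  obtain ⟨w, hw, hwQ, rfl⟩ := (wordNorm_le_iff hg).1 hl
  rw [h] at hg
  refine ⟨hg, (wordNorm_le_iff hg).2 ?_⟩
  clear hg hl
  induction w generalizing ℓ with
  | nil => exact ⟨[], by simp, by simp, rfl⟩
  | cons q w ih =>
    obtain ⟨ℓ, rfl⟩ : ∃ k, ℓ = k + 1 := ⟨ℓ - 1, by simp at hw; omega⟩
    obtain ⟨v, hv, hvQ, e⟩ :=
      ih ℓ (by simpa using hw) fun p hp => hwQ p (List.mem_cons_of_mem _ hp)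
    have hq := hwQ q List.mem_cons_self
    obtain ⟨u, hu, huQ, e'⟩ := (wordNorm_le_iff (h ▸ Subsemigroup.subset_closure hq)).1
      (hc (Set.mem_image_of_mem _ hq))
    refine ⟨u ++ v, ?_, fun q hq => (List.mem_append.1 hq).elim (huQ q) (hvQ q), ?_⟩
    · rw [List.length_append, mul_add]; omega
    · rw [List.prod_append, e, e', List.prod_cons]

theorem ballGrowth_mono (hQ : Q.Finite) {ℓ m : ℕ} (h : ℓ ≤ m) :
    ballGrowth Q ℓ ≤ ballGrowth Q m :=
  Set.ncard_le_ncard (fun _ hg => ⟨hg.1, hg.2.trans h⟩) (finite_wordBall hQ m)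

theorem exists_ballGrowth_le (hQ : Q.Finite) (hQ' : Q'.Finite)
    (h : Subsemigroup.closure Q = Subsemigroup.closure Q') :
    ∃ c : ℕ, 0 < c ∧ ∀ ℓ, ballGrowth Q ℓ ≤ ballGrowth Q' (c * ℓ) := by
  obtain ⟨c, hc, hsub⟩ := exists_wordBall_subset hQ h
  exact ⟨c, hc, fun ℓ => Set.ncard_le_ncard (hsub ℓ) (finite_wordBall hQ' _)⟩

theorem gkDim_eq_of_bounds {a c₁ c₂ : ℝ} (hc₁ : 0 < c₁)
    (h₁ : ∀ᶠ ℓ : ℕ in Filter.atTop, c₁ * (ℓ : ℝ) ^ a ≤ ballGrowth Q ℓ)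
    (h₂ : ∀ᶠ ℓ : ℕ in Filter.atTop, (ballGrowth Q ℓ : ℝ) ≤ c₂ * (ℓ : ℝ) ^ a) :
    gkDim Q = (a : EReal) := by
  have hpos : ∀ᶠ ℓ : ℕ in Filter.atTop, 0 < (ℓ : ℝ) := by
    filter_upwards [Filter.eventually_gt_atTop 0] with ℓ hl
    exact_mod_cast hl
  apply le_antisymm
  · refine EReal.le_of_forall_lt_iff_le.1 fun b hb => sInf_le ⟨b, rfl, ?_⟩
    have hb : a < b := by exact_mod_cast hb
    have hlim : Filter.Tendsto (fun ℓ : ℕ => c₂ * (ℓ : ℝ) ^ (-(b - a))) Filter.atTop (nhds 0) := by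
      have := ((tendsto_rpow_neg_atTop (sub_pos.2 hb)).comp
        (tendsto_natCast_atTop_atTop (R := ℝ))).const_mul c₂
      simpa using this
    refine squeeze_zero' (Filter.Eventually.of_forall fun ℓ => by positivity) ?_ hlim
    filter_upwards [h₂, hpos] with ℓ hl hp
    rw [neg_sub, Real.rpow_sub hp, ← mul_div_assoc]
    gcongr
  · refine le_sInf ?_
    rintro _ ⟨b, rfl, hb⟩
    rw [EReal.coe_le_coe_iff]
    by_contra! hlt
    have hev := hb.eventually (gt_mem_nhds hc₁)
    obtain ⟨ℓ, h1, h2, h3⟩ := (h₁.and (hev.and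
      (Filter.eventually_ge_atTop 1))).exists
    have h3' : (1 : ℝ) ≤ ℓ := by exact_mod_cast h3
    have hp : 0 < (ℓ : ℝ) ^ b := by positivity
    rw [div_lt_iff₀ hp] at h2
    have h4 : (ℓ : ℝ) ^ b ≤ (ℓ : ℝ) ^ a := Real.rpow_le_rpow_of_exponent_le h3' hlt.le
    have := mul_le_mul_of_nonneg_left h4 hc₁.le
    linarith

theorem gkDim_eq_of_closure_eq (hQ : Q.Finite) (hQ' : Q'.Finite)
    (h : Subsemigroup.closure Q = Subsemigroup.closure Q') {a c₁ c₂ : ℝ} (ha : 0 ≤ a)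
    (hc₁ : 0 < c₁)
    (h₁ : ∀ ℓ : ℕ, c₁ * (ℓ : ℝ) ^ a ≤ ballGrowth Q' ℓ)
    (h₂ : ∀ ℓ : ℕ, 1 ≤ ℓ → (ballGrowth Q' ℓ : ℝ) ≤ c₂ * (ℓ : ℝ) ^ a) :
    gkDim Q = (a : EReal) := by
  obtain ⟨c, hc, hle⟩ := exists_ballGrowth_le hQ hQ' h
  obtain ⟨d, hd, hge⟩ := exists_ballGrowth_le hQ' hQ h.symm
  have hd' : (0 : ℝ) < d := by exact_mod_cast hd
  refine gkDim_eq_of_bounds (c₁ := c₁ / (2 * d) ^ a) (c₂ := c₂ * c ^ a) (by positivity) ?_ ?_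
  · filter_upwards [Filter.eventually_ge_atTop d] with ℓ hl
    have hq : 1 ≤ ℓ / d := (Nat.one_le_div_iff hd).2 hl
    have hlt : ℓ < 2 * d * (ℓ / d) := by
      have h1 := Nat.lt_div_mul_add (a := ℓ) hd
      have h2 : d * 1 ≤ d * (ℓ / d) := Nat.mul_le_mul_left d hq
      nlinarith
    have hlt' : (ℓ : ℝ) / (2 * d) ≤ (ℓ / d : ℕ) := by
      rw [div_le_iff₀ (by positivity)]
      have : (ℓ : ℝ) < 2 * d * (ℓ / d : ℕ) := by exact_mod_cast hlt
      linarith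
    calc c₁ / (2 * d) ^ a * (ℓ : ℝ) ^ a = c₁ * ((ℓ : ℝ) / (2 * d)) ^ a := by
          rw [Real.div_rpow (by positivity) (by positivity)]; ring
      _ ≤ c₁ * ((ℓ / d : ℕ) : ℝ) ^ a := by gcongr
      _ ≤ ballGrowth Q' (ℓ / d) := h₁ _
      _ ≤ ballGrowth Q ℓ := by
          exact_mod_cast (hge _).trans (ballGrowth_mono hQ (Nat.mul_div_le ℓ d))
  · filter_upwards [Filter.eventually_ge_atTop 1] with ℓ hl
    calc (ballGrowth Q ℓ : ℝ) ≤ ballGrowth Q' (c * ℓ) := by exact_mod_cast hle ℓ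
      _ ≤ c₂ * ((c * ℓ : ℕ) : ℝ) ^ a := h₂ _ (Nat.mul_pos hc hl)
      _ = c₂ * c ^ a * (ℓ : ℝ) ^ a := by
          rw [Nat.cast_mul, Real.mul_rpow (by positivity) (by positivity), mul_assoc]

end Growth

/-! ### Balls of the semigroup generated by `s` and `f` -/

theorem reach_iff_word {ℓ : ℕ} {g : RightTransf ℤ} :
    Reach 1 1 ℓ g ↔ ∃ w : List (RightTransf ℤ), w.length = ℓ ∧
      (∀ q ∈ w, q ∈ ({s, f} : Set (RightTransf ℤ))) ∧ w.prod = g := by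
  constructor
  · intro h
    induction h with
    | one => exact ⟨[], rfl, by simp, rfl⟩
    | mul_s _ ih =>
      obtain ⟨w, rfl, hw, rfl⟩ := ih
      exact ⟨w ++ [s], by simp, by simpa [or_imp, forall_and] using hw, by simp⟩
    | mul_f _ ih =>
      obtain ⟨w, rfl, hw, rfl⟩ := ih
      exact ⟨w ++ [f], by simp, by simpa [or_imp, forall_and] using hw, by simp⟩
  · rintro ⟨w, rfl, hw, rfl⟩
    induction w using List.reverseRecOn with
    | nil => exact .one
    | append_singleton w q ih =>
      have ih := ih fun p hp => hw p (List.mem_append_left _ hp)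
      rw [List.length_append, List.length_singleton, List.prod_append, List.prod_singleton]
      rcases hw q (by simp) with rfl | rfl
      exacts [ih.mul_s, ih.mul_f]

theorem finite_generators : ({s, f} : Set (RightTransf ℤ)).Finite := Set.toFinite _

theorem Reach.mem_closure {a b ℓ : ℕ} {g : RightTransf ℤ} (h : Reach a b ℓ g) :
    g ∈ Subsemigroup.closure ({s, f} : Set (RightTransf ℤ)) := by
  have hs : s ∈ Subsemigroup.closure ({s, f} : Set (RightTransf ℤ)) :=
    Subsemigroup.subset_closure (by simp)
  have hf : f ∈ Subsemigroup.closure ({s, f} : Set (RightTransf ℤ)) :=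
    Subsemigroup.subset_closure (by simp)
  induction h with
  | one => exact s_mul_s ▸ mul_mem hs hs
  | mul_s _ ih => exact mul_mem ih hs
  | mul_f _ ih => exact mul_mem ih hf

theorem mem_wordBall_iff {ℓ : ℕ} {g : RightTransf ℤ} :
    g ∈ wordBall ({s, f} : Set (RightTransf ℤ)) ℓ ↔ ∃ m ≤ ℓ, Reach 1 1 m g := by
  constructor
  · rintro ⟨hg, hl⟩
    obtain ⟨w, hw, hwQ, e⟩ := (wordNorm_le_iff hg).1 hl
    exact ⟨w.length, hw, reach_iff_word.2 ⟨w, rfl, hwQ, e⟩⟩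
  · rintro ⟨m, hm, hr⟩
    obtain ⟨w, rfl, hwQ, e⟩ := reach_iff_word.1 hr
    exact ⟨hr.mem_closure, (wordNorm_le_iff hr.mem_closure).2 ⟨w, hm, hwQ, e⟩⟩

theorem γ_le_card {ℓ : ℕ} {Y : Finset (RightTransf ℤ)}
    (h : ∀ m ≤ ℓ, ∀ g, Reach 1 1 m g → g ∈ Y) : γ ℓ ≤ Y.card := by
  rw [← Set.ncard_coe_finset]
  refine Set.ncard_le_ncard (fun g hg => ?_) (Finset.finite_toSet Y)
  obtain ⟨m, hm, hr⟩ := mem_wordBall_iff.1 hg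
  exact h m hm g hr

theorem card_le_γ {ℓ : ℕ} {Y : Finset (RightTransf ℤ)} (h : Within 0 ℓ Y) : Y.card ≤ γ ℓ := by
  rw [← Set.ncard_coe_finset]
  exact Set.ncard_le_ncard (fun g hg => mem_wordBall_iff.2 (h g hg))
    (finite_wordBall finite_generators ℓ)

theorem Reach.cases_right {m : ℕ} {g : RightTransf ℤ} (h : Reach 1 1 m g) :
    g = 1 ∨ (g = s ∧ 1 ≤ m) ∨ (∃ k j, j + 1 ≤ m ∧ Reach 1 1 j k ∧ g = k * f) ∨
      ∃ k j, j + 2 ≤ m ∧ Reach 1 1 j k ∧ g = k * f * s := by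
  induction h with
  | one => exact Or.inl rfl
  | mul_s _ ih =>
    rcases ih with rfl | ⟨rfl, _⟩ | ⟨k, j, hj, hr, rfl⟩ | ⟨k, j, hj, hr, rfl⟩
    · exact Or.inr (Or.inl ⟨one_mul _, by omega⟩)
    · exact Or.inl s_mul_s
    · exact Or.inr (Or.inr (Or.inr ⟨k, j, by omega, hr, rfl⟩))
    · exact Or.inr (Or.inr (Or.inl ⟨k, j, by omega, hr, mul_s_cancel _⟩))
  | mul_f hr _ => exact Or.inr (Or.inr (Or.inl ⟨_, _, le_rfl, hr, rfl⟩))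

section

open scoped Classical

theorem γ_zero_le : γ 0 ≤ 1 := by
  refine (γ_le_card (Y := {1}) fun m hm g hr => ?_).trans_eq (Finset.card_singleton _)
  rcases hr.cases_right with rfl | ⟨rfl, _⟩ | ⟨k, j, hj, -, -⟩ | ⟨k, j, hj, -, -⟩
  · simp
  all_goals omega

theorem γ_one_le : γ 1 ≤ 3 := by
  refine (γ_le_card (Y := {1, s, f}) fun m hm g hr => ?_).trans Finset.card_le_three
  rcases hr.cases_right with rfl | ⟨rfl, _⟩ | ⟨k, j, hj, hk, rfl⟩ | ⟨k, j, hj, -, -⟩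
  · simp
  · simp
  · rcases hk.cases_right with rfl | ⟨rfl, _⟩ | ⟨k, j, hj, -, -⟩ | ⟨k, j, hj, -, -⟩
    · simp
    all_goals omega
  · omega

theorem γ_add_two_le (ℓ : ℕ) : γ (ℓ + 2) ≤ 2 + γ (ℓ + 1) + γ ℓ := by
  have hb := fun ℓ => finite_wordBall finite_generators ℓ
  have hγ : ∀ ℓ, (hb ℓ).toFinset.card = γ ℓ := fun ℓ =>
    (Set.ncard_eq_toFinset_card _ (hb ℓ)).symm
  have h1 : ({1, s} : Finset (RightTransf ℤ)).card ≤ 2 := Finset.card_le_two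
  have h2 := Finset.card_image_le (s := (hb (ℓ + 1)).toFinset) (f := fun k => k * f)
  have h3 := Finset.card_image_le (s := (hb ℓ).toFinset) (f := fun k => k * f * s)
  rw [hγ] at h2 h3
  have h4 := Finset.card_union_le (({1, s} : Finset (RightTransf ℤ)) ∪
    (hb (ℓ + 1)).toFinset.image fun k => k * f) ((hb ℓ).toFinset.image fun k => k * f * s)
  have h5 := Finset.card_union_le ({1, s} : Finset (RightTransf ℤ))
    ((hb (ℓ + 1)).toFinset.image fun k => k * f)
  have h6 : γ (ℓ + 2) ≤ (({1, s} : Finset (RightTransf ℤ)) ∪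
      ((hb (ℓ + 1)).toFinset.image fun k => k * f) ∪
      ((hb ℓ).toFinset.image fun k => k * f * s)).card := by
    refine γ_le_card fun m hm g hr => ?_
    simp only [Finset.mem_union, Finset.mem_insert, Finset.mem_singleton, Finset.mem_image,
      Set.Finite.mem_toFinset, mem_wordBall_iff]
    rcases hr.cases_right with rfl | ⟨rfl, _⟩ | ⟨k, j, hj, hk, rfl⟩ | ⟨k, j, hj, hk, rfl⟩
    · exact Or.inl (Or.inl (Or.inl rfl))
    · exact Or.inl (Or.inl (Or.inr rfl))
    · exact Or.inl (Or.inr ⟨k, ⟨j, by omega, hk⟩, rfl⟩)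
    · exact Or.inr ⟨k, ⟨j, by omega, hk⟩, rfl⟩
  omega

/-! ### Combinatorial bounds for the growth function -/

theorem γ_le_count_pair {d ℓ : ℕ} (h : ℓ + 2 < (d + 4).fib) : γ ℓ ≤ (count (2, 2, 2) d).1 := by
  have hc : ({1, s} : Finset (RightTransf ℤ)).card ≤ 2 := Finset.card_le_two
  refine (γ_le_card fun m hm g hr => hr.mem_iterate_step_pair (n := 0) (d := d) ?_).trans
    (closed_pair.le_count hc ((cardSF_le_card _).trans hc) ((cardFF_le_card _).trans hc) d).1
  simp only [zero_add]
  exact lt_of_le_of_lt (Nat.add_le_add_right hm 2) h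

theorem γ_le_count_six {d ℓ : ℕ} (h : ℓ + 2 < 2 * (d + 3).fib) : γ ℓ ≤ (count (6, 6, 4) d).1 := by
  refine (γ_le_card fun m hm g hr => hr.mem_iterate_step_sixSet (n := 0) (d := d) ?_).trans
    (closed_sixSet.le_count card_sixSet_le ((cardSF_le_card _).trans card_sixSet_le)
      cardFF_sixSet_le d).1
  simp only [zero_add]
  exact lt_of_le_of_lt (Nat.add_le_add_right hm 2) h

theorem count_le_γ {Y : Finset (RightTransf ℤ)} (hY : GenSet Y) {v : ℕ × ℕ × ℕ}
    (h1 : v.1 ≤ Y.card) (h2 : v.2.1 ≤ cardSF Y) (h3 : v.2.2 ≤ cardFF Y) {d x ℓ : ℕ}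
    (hw : Within d x Y) (hl : x + (d + 2).fib + (d + 4).fib ≤ ℓ + 4) : (count v d).1 ≤ γ ℓ := by
  refine (hY.count_le h1 h2 h3 d).1.trans (card_le_γ (Within.iterate_step (x := x) ?_ ?_))
  · rwa [zero_add]
  · rw [zero_add, zero_add, zero_add, show (2 : ℕ).fib = 1 from rfl, show (4 : ℕ).fib = 3 from rfl]
    omega

theorem count_one_le_γ {d ℓ : ℕ} (h : (d + 2).fib + (d + 4).fib ≤ ℓ + 4) :
    (count (1, 1, 1) d).1 ≤ γ ℓ := by
  refine count_le_γ (Y := {1}) (x := 0) ?_ ?_ ?_ ?_ ?_ (by omega)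
  · intro g hg; rw [Finset.mem_singleton.1 hg]; exact .one
  · simp
  · rw [cardSF, Finset.filter_true_of_mem]
    · simp
    · simpa using not_fixSF_one
  · rw [cardFF, Finset.filter_true_of_mem]
    · simp
    · simpa using not_fixFF_one
  · intro g hg; rw [Finset.mem_singleton.1 hg]; exact ⟨0, le_rfl, .one⟩

theorem count_pair_le_γ {d ℓ : ℕ} (h : (d + 5).fib ≤ ℓ + 4) :
    (count (2, 2, 2) d).1 ≤ γ ℓ := by
  have e3 : (d + 3).fib = (d + 1).fib + (d + 2).fib := Nat.fib_add_two
  have e5 : (d + 5).fib = (d + 3).fib + (d + 4).fib := Nat.fib_add_two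
  have hc : ({1, s} : Finset (RightTransf ℤ)) = step ∅ := step_empty.symm
  refine count_le_γ (Y := {1, s}) (x := (d + 1).fib) closed_pair.gen ?_ ?_ ?_ ?_ (by omega)
  · rw [hc, card_step]; omega
  · rw [hc, cardSF_step]; exact Nat.le_add_right _ _
  · rw [hc, cardFF_step]; exact Nat.le_add_right _ _
  · intro g hg
    simp only [Finset.mem_insert, Finset.mem_singleton] at hg
    rcases hg with rfl | rfl
    · exact ⟨0, by omega, .one⟩
    · exact ⟨0 + (d + 1).fib, by omega, by simpa using Reach.one.mul_s⟩

theorem count_five_le_γ {d ℓ : ℕ} (h : 2 * (d + 4).fib ≤ ℓ + 4) :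
    (count (5, 5, 3) d).1 ≤ γ ℓ := by
  have e3 : (d + 3).fib = (d + 1).fib + (d + 2).fib := Nat.fib_add_two
  have e4 : (d + 4).fib = (d + 2).fib + (d + 3).fib := Nat.fib_add_two
  have hg : GenSet {1} := fun g hg => by rw [Finset.mem_singleton.1 hg]; exact .one
  have h1 : cardSF {1} = 1 := by
    rw [cardSF, Finset.filter_true_of_mem]
    · simp
    · simpa using not_fixSF_one
  have h2 : cardFF {1} = 1 := by
    rw [cardFF, Finset.filter_true_of_mem]
    · simp
    · simpa using not_fixFF_one
  have c1 := le_card_step {1}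
  have c2 := le_cardSF_step hg
  have c3 := le_cardFF_step {1}
  rw [Finset.card_singleton] at c1
  rw [h1] at c1 c2 c3
  rw [h2] at c2
  refine count_le_γ (Y := (step {1}).erase (s * f * s)) (x := (d + 3).fib) ?_ ?_ ?_ ?_ ?_ (by omega)
  · exact fun g hg' => hg.step g (Finset.mem_of_mem_erase hg')
  · have := Finset.pred_card_le_card_erase (s := step {1}) (a := s * f * s)
    simp only; omega
  · have := Finset.pred_card_le_card_erase (s := (step {1}).filter fun g => ¬ FixSF g)
      (a := s * f * s)
    rw [← Finset.filter_erase] at this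
    unfold cardSF at *
    simp only; omega
  · have := Finset.pred_card_le_card_erase (s := (step {1}).filter fun g => ¬ FixFF g)
      (a := s * f * s)
    rw [← Finset.filter_erase] at this
    unfold cardFF at *
    simp only; omega
  · intro g hg
    obtain ⟨hne, hg⟩ := Finset.mem_erase.1 hg
    have hr : Reach (d + 1).fib (d + 2).fib (0 + (d + 2).fib) f := by
      simpa using Reach.one.mul_f
    rcases mem_step.1 hg with rfl | rfl | hk | ⟨k, hk, rfl⟩
    · exact ⟨0, by omega, .one⟩
    · exact ⟨0 + (d + 1).fib, by omega, by simpa using Reach.one.mul_s⟩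
    all_goals
      obtain ⟨h, hh, rfl | rfl⟩ := mem_stepOdd.1 hk
      all_goals
        rw [Finset.mem_singleton.1 hh, lift_one] at hne ⊢
    · exact ⟨_, by omega, hr⟩
    · exact ⟨_, by omega, hr.s_mul⟩
    · exact ⟨_, by omega, hr.mul_s⟩
    · exact absurd rfl hne

end

/-! ### The exponent and the constants -/

section Analysis

open scoped goldenRatio
open Real (goldenRatio_pos one_lt_goldenRatio goldenRatio_sq)

theorem goldenRatio_pow_succ (k : ℕ) : φ ^ (k + 1) = (k + 1).fib * φ + k.fib := by
  rw [← Real.goldenRatio_mul_fib_succ_add_fib, mul_comm]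

theorem sqrt_five_eq : √5 = 2 * φ - 1 := by
  have h1 := Real.goldenRatio_sub_goldenConj
  have h2 := Real.goldenRatio_add_goldenConj
  linarith

theorem lt_goldenRatio : 1.618 < φ := by
  have := goldenRatio_sq
  have := goldenRatio_pos
  nlinarith

theorem goldenRatio_lt : φ < 1.61804 := by
  have := goldenRatio_sq
  have := one_lt_goldenRatio
  nlinarith

theorem log_goldenRatio_pos : 0 < Real.log φ := Real.log_pos one_lt_goldenRatio

theorem goldenRatio_rpow_α : φ ^ α = 2 * φ := by
  rw [Real.rpow_def_of_pos goldenRatio_pos, α, mul_add, mul_one, mul_div_cancel₀ _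
    log_goldenRatio_pos.ne', Real.exp_add, Real.exp_log goldenRatio_pos,
    Real.exp_log two_pos, mul_comm]

theorem goldenRatio_pow_rpow_α (m : ℕ) : (φ ^ m) ^ α = (2 * φ) ^ m := by
  rw [← Real.rpow_natCast φ m, ← Real.rpow_mul goldenRatio_pos.le, mul_comm,
    Real.rpow_mul goldenRatio_pos.le, goldenRatio_rpow_α, Real.rpow_natCast]

theorem lt_α : 39 / 16 < α := by
  have h : φ ^ 23 < 2 ^ 16 := by
    rw [goldenRatio_pow_succ 22]
    have := goldenRatio_lt
    norm_num
    linarith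
  have h := Real.log_lt_log (pow_pos goldenRatio_pos _) h
  rw [Real.log_pow, Real.log_pow] at h
  have h2 : 23 / 16 < Real.log 2 / Real.log φ := by
    rw [lt_div_iff₀ log_goldenRatio_pos]
    push_cast at h
    linarith
  rw [α]
  linarith

theorem α_lt : α < 22 / 9 := by
  have h : (2 : ℝ) ^ 9 < φ ^ 13 := by
    rw [goldenRatio_pow_succ 12]
    have := lt_goldenRatio
    norm_num
    linarith
  have h := Real.log_lt_log (by norm_num) h
  rw [Real.log_pow, Real.log_pow] at h
  have h2 : Real.log 2 / Real.log φ < 13 / 9 := by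
    rw [div_lt_iff₀ log_goldenRatio_pos]
    push_cast at h
    linarith
  rw [α]
  linarith

theorem irrational_α : Irrational α := by
  have key : Irrational (Real.log 2 / Real.log φ) := by
    have hpos : 0 < Real.log 2 / Real.log φ :=
      div_pos (Real.log_pos one_lt_two) log_goldenRatio_pos
    rintro ⟨q, hq⟩
    have hq0 : 0 < q := by rw [← hq] at hpos; exact_mod_cast hpos
    obtain ⟨p, hp⟩ : ∃ p : ℕ, q.num = p + 1 := ⟨(q.num - 1).toNat, by
      have := Rat.num_pos.2 hq0
      omega⟩
    have hq' : (q : ℝ) = ((p : ℝ) + 1) / q.den := by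
      rw [Rat.cast_def, hp]; push_cast; ring
    have hd : (q.den : ℝ) ≠ 0 := by exact_mod_cast q.den_nz
    rw [hq', div_eq_div_iff hd log_goldenRatio_pos.ne'] at hq
    have hpow : φ ^ (p + 1) = 2 ^ q.den := by
      apply Real.log_injOn_pos (Set.mem_Ioi.2 (pow_pos goldenRatio_pos _))
        (Set.mem_Ioi.2 (by positivity))
      rw [Real.log_pow, Real.log_pow]
      push_cast
      linarith
    rw [goldenRatio_pow_succ] at hpow
    have hirr := ((Real.goldenRatio_irrational.natCast_mul
      (Nat.fib_pos.2 p.succ_pos).ne').add_natCast p.fib)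
    refine hirr ⟨2 ^ q.den, ?_⟩
    push_cast
    exact hpow.symm
  simpa [α] using key.natCast_add 1

theorem D_eq : D = 2 / (5 * φ ^ 2) * √5 ^ α := by
  have h5 : √5 * √5 = 5 := Real.mul_self_sqrt (by norm_num)
  rw [D, ← sqrt_five_eq, mul_right_comm, h5]
  ring

theorem C_eq : C = D / (2 * φ) ^ α := by
  rw [C, D, div_div]

theorem D_pos : 0 < D := by
  have := goldenRatio_pos
  rw [D_eq]
  positivity

theorem C_pos : 0 < C := by
  have := goldenRatio_pos
  have := D_pos
  rw [C_eq]
  positivity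

theorem D_mul_rpow {x : ℝ} (hx : 0 ≤ x) : D * x ^ α = 2 / (5 * φ ^ 2) * (√5 * x) ^ α := by
  rw [D_eq, Real.mul_rpow (by positivity) hx, mul_assoc]

theorem scaled_rpow {κ : ℝ} (hκ : 0 ≤ κ) (m : ℕ) :
    2 / (5 * φ ^ 2) * (κ * φ ^ (m + 2)) ^ α = 8 / 5 * κ ^ α * (2 * φ) ^ m := by
  have := goldenRatio_pos
  rw [Real.mul_rpow hκ (by positivity), goldenRatio_pow_rpow_α, pow_add, mul_pow _ _ 2]
  field_simp
  ring

theorem le_D_mul_rpow {κ c x : ℝ} {m : ℕ} (hκ : 0 ≤ κ) (hc : c ≤ κ ^ α)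
    (h : κ * φ ^ (m + 2) ≤ √5 * x) : 8 / 5 * c * (2 * φ) ^ m ≤ D * x ^ α := by
  have hφ := goldenRatio_pos
  have hx : 0 ≤ x := by
    have : 0 ≤ √5 * x := le_trans (by positivity) h
    exact nonneg_of_mul_nonneg_right this (by positivity)
  have hα : 0 ≤ α := by linarith [lt_α]
  calc 8 / 5 * c * (2 * φ) ^ m ≤ 8 / 5 * κ ^ α * (2 * φ) ^ m := by gcongr
    _ = 2 / (5 * φ ^ 2) * (κ * φ ^ (m + 2)) ^ α := (scaled_rpow hκ m).symm
    _ ≤ 2 / (5 * φ ^ 2) * (√5 * x) ^ α := by gcongr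
    _ = D * x ^ α := (D_mul_rpow hx).symm

theorem C_mul_rpow_le {κ c x : ℝ} {m : ℕ} (hκ : 0 ≤ κ) (hc : κ ^ α ≤ c) (hx : 0 ≤ x)
    (h : √5 * x ≤ 2 * κ * φ ^ (m + 3)) : C * x ^ α ≤ 8 / 5 * c * (2 * φ) ^ m := by
  have hφ := goldenRatio_pos
  have hα : 0 ≤ α := by linarith [lt_α]
  have e : C * x ^ α = 2 / (5 * φ ^ 2) * (√5 * x / (2 * φ)) ^ α := by
    rw [C_eq, div_mul_eq_mul_div, D_mul_rpow hx, Real.div_rpow (by positivity) (by positivity),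
      mul_div_assoc]
  have h' : √5 * x / (2 * φ) ≤ κ * φ ^ (m + 2) := by
    rw [div_le_iff₀ (by positivity)]
    calc √5 * x ≤ _ := h
      _ = _ := by ring
  calc C * x ^ α = 2 / (5 * φ ^ 2) * (√5 * x / (2 * φ)) ^ α := e
    _ ≤ 2 / (5 * φ ^ 2) * (κ * φ ^ (m + 2)) ^ α := by gcongr
    _ = 8 / 5 * κ ^ α * (2 * φ) ^ m := scaled_rpow hκ m
    _ ≤ 8 / 5 * c * (2 * φ) ^ m := by gcongr

theorem le_rpow_of_pow_le {κ c e : ℝ} {p q : ℕ} (hκ : 0 < κ) (hc : 0 ≤ c) (hq : q ≠ 0)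
    (h : c ^ q ≤ κ ^ p) (he : κ ^ ((p : ℝ) / q) ≤ κ ^ e) : c ≤ κ ^ e := by
  refine le_trans ?_ he
  rw [div_eq_mul_inv, Real.rpow_mul hκ.le, Real.rpow_natCast,
    Real.le_rpow_inv_iff_of_pos hc (by positivity) (by positivity), Real.rpow_natCast]
  exact h

theorem rpow_le_of_le_pow {κ c e : ℝ} {p q : ℕ} (hκ : 0 < κ) (hc : 0 ≤ c) (hq : q ≠ 0)
    (h : κ ^ p ≤ c ^ q) (he : κ ^ e ≤ κ ^ ((p : ℝ) / q)) : κ ^ e ≤ c := by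
  refine le_trans he ?_
  rw [div_eq_mul_inv, Real.rpow_mul hκ.le, Real.rpow_natCast,
    Real.rpow_inv_le_iff_of_pos (by positivity) hc (by positivity), Real.rpow_natCast]
  exact h

theorem le_rpow_α_of_one_le {κ c : ℝ} (hκ : 1 ≤ κ) (hc : 0 ≤ c) (h : c ^ 5 ≤ κ ^ 12) :
    c ≤ κ ^ α :=
  le_rpow_of_pow_le (by linarith) hc (by norm_num) h
    (Real.rpow_le_rpow_of_exponent_le hκ (by norm_num; linarith [lt_α]))

theorem le_rpow_α_of_le_one {κ c : ℝ} (hκ : 0 < κ) (hκ1 : κ ≤ 1) (hc : 0 ≤ c)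
    (h : c ^ 2 ≤ κ ^ 5) : c ≤ κ ^ α :=
  le_rpow_of_pow_le hκ hc (by norm_num) h
    (Real.rpow_le_rpow_of_exponent_ge hκ hκ1 (by norm_num; linarith [α_lt]))

theorem rpow_α_le_of_one_le {κ c : ℝ} (hκ : 1 ≤ κ) (hc : 0 ≤ c) (h : κ ^ 5 ≤ c ^ 2) :
    κ ^ α ≤ c :=
  rpow_le_of_le_pow (by linarith) hc (by norm_num) h
    (Real.rpow_le_rpow_of_exponent_le hκ (by norm_num; linarith [α_lt]))

theorem rpow_α_le_of_le_one {κ c : ℝ} (hκ : 0 < κ) (hκ1 : κ ≤ 1) (hc : 0 ≤ c)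
    (h : κ ^ 12 ≤ c ^ 5) : κ ^ α ≤ c :=
  rpow_le_of_le_pow hκ hc (by norm_num) h
    (Real.rpow_le_rpow_of_exponent_ge hκ hκ1 (by norm_num; linarith [lt_α]))

/-! ### Growth of the counting sequences -/

theorem count_le_of_le {v : ℕ × ℕ × ℕ} {A : ℝ} (h1 : (v.1 : ℝ) ≤ A * φ + 2 / 5)
    (h2 : (v.2.1 : ℝ) ≤ A - 6 / 5) (h3 : (v.2.2 : ℝ) ≤ A * (φ - 1) - 2 / 5) (d : ℕ) :
    ((count v d).1 : ℝ) ≤ A * φ * (2 * φ) ^ d + 2 / 5 ∧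
      ((count v d).2.1 : ℝ) ≤ A * (2 * φ) ^ d - 6 / 5 ∧
      ((count v d).2.2 : ℝ) ≤ A * (φ - 1) * (2 * φ) ^ d - 2 / 5 := by
  induction d with
  | zero => simpa [count] using ⟨h1, h2, h3⟩
  | succ d ih =>
    obtain ⟨i1, i2, i3⟩ := ih
    have e1 : A * φ * (2 * φ) ^ (d + 1) = 2 * (A * φ * (2 * φ) ^ d + A * (2 * φ) ^ d) := by
      rw [pow_succ]; linear_combination (2 * A * (2 * φ) ^ d) * goldenRatio_sq
    have e2 : A * (2 * φ) ^ (d + 1) = 2 * (A * (2 * φ) ^ d + A * (φ - 1) * (2 * φ) ^ d) := by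
      rw [pow_succ]; ring
    have e3 : A * (φ - 1) * (2 * φ) ^ (d + 1) = 2 * (A * (2 * φ) ^ d) := by
      rw [pow_succ]; linear_combination (2 * A * (2 * φ) ^ d) * goldenRatio_sq
    simp only [count]
    push_cast
    refine ⟨?_, ?_, ?_⟩ <;> linarith

theorem le_count_of_le {v : ℕ × ℕ × ℕ} {A : ℝ} {d₀ : ℕ}
    (h1 : A * φ * (2 * φ) ^ d₀ + 2 / 5 ≤ (count v d₀).1)
    (h2 : A * (2 * φ) ^ d₀ - 6 / 5 ≤ (count v d₀).2.1)
    (h3 : A * (φ - 1) * (2 * φ) ^ d₀ - 2 / 5 ≤ (count v d₀).2.2) {d : ℕ} (hd : d₀ ≤ d) :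
    A * φ * (2 * φ) ^ d + 2 / 5 ≤ (count v d).1 := by
  suffices A * φ * (2 * φ) ^ d + 2 / 5 ≤ (count v d).1 ∧
      A * (2 * φ) ^ d - 6 / 5 ≤ (count v d).2.1 ∧
      A * (φ - 1) * (2 * φ) ^ d - 2 / 5 ≤ (count v d).2.2 from this.1
  induction d, hd using Nat.le_induction with
  | base => exact ⟨h1, h2, h3⟩
  | succ d _ ih =>
    obtain ⟨i1, i2, i3⟩ := ih
    have e1 : A * φ * (2 * φ) ^ (d + 1) = 2 * (A * φ * (2 * φ) ^ d + A * (2 * φ) ^ d) := by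
      rw [pow_succ]; linear_combination (2 * A * (2 * φ) ^ d) * goldenRatio_sq
    have e2 : A * (2 * φ) ^ (d + 1) = 2 * (A * (2 * φ) ^ d + A * (φ - 1) * (2 * φ) ^ d) := by
      rw [pow_succ]; ring
    have e3 : A * (φ - 1) * (2 * φ) ^ (d + 1) = 2 * (A * (2 * φ) ^ d) := by
      rw [pow_succ]; linear_combination (2 * A * (2 * φ) ^ d) * goldenRatio_sq
    simp only [count]
    push_cast
    refine ⟨?_, ?_, ?_⟩ <;> linarith

theorem sqrt_five_mul_fib (m : ℕ) : |√5 * m.fib - φ ^ m| ≤ 1 := by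
  rw [Real.coe_fib_eq, mul_div_cancel₀ _ (by positivity), sub_sub_cancel_left, abs_neg, abs_pow]
  exact pow_le_one₀ (abs_nonneg _)
    (abs_le.2 ⟨Real.neg_one_lt_goldenConj.le, Real.goldenConj_neg.le.trans zero_le_one⟩)

end Analysis

/-! ### The bounds for the growth function -/

section Bounds

open scoped goldenRatio
open Real (goldenRatio_pos one_lt_goldenRatio goldenRatio_sq)

theorem two_mul_goldenRatio_pow (m : ℕ) :
    (2 * φ) ^ (m + 1) = 2 ^ (m + 1) * ((m + 1).fib * φ + m.fib) := by
  rw [mul_pow, goldenRatio_pow_succ]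

theorem le_two_mul_goldenRatio_pow {m n : ℕ} (h : m ≤ n) : (2 * φ) ^ m ≤ (2 * φ) ^ n :=
  pow_le_pow_right₀ (by linarith [one_lt_goldenRatio]) h

theorem γ_le_D_mul_of_le {ℓ₀ ℓ m : ℕ} {κ c : ℝ} (hℓ : ℓ₀ ≤ ℓ) (hκ : 0 ≤ κ) (hc : c ≤ κ ^ α)
    (h : κ * φ ^ (m + 2) ≤ √5 * ℓ₀) (hγ : (γ ℓ : ℝ) ≤ 8 / 5 * c * (2 * φ) ^ m) :
    (γ ℓ : ℝ) ≤ D * (ℓ : ℝ) ^ α := by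
  refine hγ.trans (le_D_mul_rpow hκ hc (h.trans ?_))
  have : (ℓ₀ : ℝ) ≤ ℓ := by exact_mod_cast hℓ
  gcongr

theorem C_mul_le_γ_of_le {ℓ₁ ℓ m : ℕ} {κ c : ℝ} (hℓ : ℓ ≤ ℓ₁) (hκ : 0 ≤ κ) (hc : κ ^ α ≤ c)
    (h : √5 * ℓ₁ ≤ 2 * κ * φ ^ (m + 3)) (hγ : 8 / 5 * c * (2 * φ) ^ m ≤ (γ ℓ : ℝ)) :
    C * (ℓ : ℝ) ^ α ≤ γ ℓ := by
  refine (C_mul_rpow_le hκ hc (by positivity) (le_trans ?_ h)).trans hγ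
  have : (ℓ : ℝ) ≤ ℓ₁ := by exact_mod_cast hℓ
  gcongr

theorem γ_le_D_mul_small {ℓ : ℕ} (h3 : 3 ≤ ℓ) (h19 : ℓ < 19) : (γ ℓ : ℝ) ≤ D * (ℓ : ℝ) ^ α := by
  have hlo := lt_goldenRatio
  have hhi := goldenRatio_lt
  have cast : ∀ {n : ℕ}, γ ℓ ≤ n → (γ ℓ : ℝ) ≤ n := fun h => by exact_mod_cast h
  have g0 := γ_zero_le
  have g1 := γ_one_le
  have g2 := γ_add_two_le 0
  have g3 := γ_add_two_le 1
  have g4 := γ_add_two_le 2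
  have g5 := γ_add_two_le 3
  have g6 := γ_add_two_le 4
  have g7 := γ_add_two_le 5
  simp only [zero_add, Nat.reduceAdd] at g2 g3 g4 g5 g6 g7
  rcases (by omega : ℓ = 3 ∨ ℓ = 4 ∨ ℓ = 5 ∨ ℓ = 6 ∨ ℓ = 7 ∨ (8 ≤ ℓ ∧ ℓ ≤ 10) ∨
    (11 ≤ ℓ ∧ ℓ ≤ 13) ∨ 14 ≤ ℓ) with h | h | h | h | h | ⟨h, h'⟩ | ⟨h, h'⟩ | h
  · refine γ_le_D_mul_of_le (κ := 0.97) (c := 0.9) (m := 2) h.ge (by norm_num)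
      (le_rpow_α_of_le_one (by norm_num) (by norm_num) (by norm_num) (by norm_num)) ?_
      ((cast (show γ ℓ ≤ 11 by subst h; omega)).trans ?_)
    · rw [sqrt_five_eq, goldenRatio_pow_succ]; norm_num; linarith
    · rw [two_mul_goldenRatio_pow]; norm_num; linarith
  · refine γ_le_D_mul_of_le (κ := 1.3) (c := 1.8) (m := 2) h.ge (by norm_num)
      (le_rpow_α_of_one_le (by norm_num) (by norm_num) (by norm_num)) ?_
      ((cast (show γ ℓ ≤ 19 by subst h; omega)).trans ?_)
    · rw [sqrt_five_eq, goldenRatio_pow_succ]; norm_num; linarith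
    · rw [two_mul_goldenRatio_pow]; norm_num; linarith
  · refine γ_le_D_mul_of_le (κ := 1) (c := 1) (m := 3) h.ge (by norm_num)
      (Real.one_rpow α).ge ?_ ((cast (show γ ℓ ≤ 32 by subst h; omega)).trans ?_)
    · rw [sqrt_five_eq, goldenRatio_pow_succ]; norm_num; linarith
    · rw [two_mul_goldenRatio_pow]; norm_num; linarith
  · refine γ_le_D_mul_of_le (κ := 1) (c := 1) (m := 3) h.ge (by norm_num)
      (Real.one_rpow α).ge ?_ ((cast (show γ ℓ ≤ 53 by subst h; omega)).trans ?_)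
    · rw [sqrt_five_eq, goldenRatio_pow_succ]; norm_num; linarith
    · rw [two_mul_goldenRatio_pow]; norm_num; linarith
  · refine γ_le_D_mul_of_le (κ := 1.4) (c := 2.2) (m := 3) h.ge (by norm_num)
      (le_rpow_α_of_one_le (by norm_num) (by norm_num) (by norm_num)) ?_
      ((cast (show γ ℓ ≤ 87 by subst h; omega)).trans ?_)
    · rw [sqrt_five_eq, goldenRatio_pow_succ]; norm_num; linarith
    · rw [two_mul_goldenRatio_pow]; norm_num; linarith
  · have hγ : γ ℓ ≤ 154 := γ_le_count_pair (d := 3) (by norm_num; omega)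
    refine γ_le_D_mul_of_le (κ := 0.99) (c := 0.97) (m := 4) h (by norm_num)
      (le_rpow_α_of_le_one (by norm_num) (by norm_num) (by norm_num) (by norm_num)) ?_
      ((cast hγ).trans ?_)
    · rw [sqrt_five_eq, goldenRatio_pow_succ]; norm_num; linarith
    · rw [two_mul_goldenRatio_pow]; norm_num; linarith
  · have hγ : γ ℓ ≤ 346 := γ_le_count_six (d := 3) (by norm_num; omega)
    refine γ_le_D_mul_of_le (κ := 1.37) (c := 2.12) (m := 4) h (by norm_num)
      (le_rpow_α_of_one_le (by norm_num) (by norm_num) (by norm_num)) ?_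
      ((cast hγ).trans ?_)
    · rw [sqrt_five_eq, goldenRatio_pow_succ]; norm_num; linarith
    · rw [two_mul_goldenRatio_pow]; norm_num; linarith
  · have hγ : γ ℓ ≤ 538 := γ_le_count_pair (d := 4) (by norm_num; omega)
    refine γ_le_D_mul_of_le (κ := 1) (c := 1) (m := 5) h (by norm_num)
      (Real.one_rpow α).ge ?_ ((cast hγ).trans ?_)
    · rw [sqrt_five_eq, goldenRatio_pow_succ]; norm_num; linarith
    · rw [two_mul_goldenRatio_pow]; norm_num; linarith

theorem γ_le_D_mul {ℓ : ℕ} (h3 : 3 ≤ ℓ) : (γ ℓ : ℝ) ≤ D * (ℓ : ℝ) ^ α := by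
  rcases lt_or_ge ℓ 19 with h19 | h19
  · exact γ_le_D_mul_small h3 h19
  have hlo := lt_goldenRatio
  have hhi := goldenRatio_lt
  have hsq := goldenRatio_sq
  have h5 := sqrt_five_eq
  obtain ⟨d, hd⟩ : ∃ d, (ℓ + 2).greatestFib = d + 8 := by
    have : 8 ≤ (ℓ + 2).greatestFib := Nat.le_greatestFib.2 (by norm_num; omega)
    exact ⟨_, (Nat.sub_add_cancel this).symm⟩
  have hge := Nat.fib_greatestFib_le (ℓ + 2)
  have hlt := Nat.lt_fib_greatestFib_add_one (ℓ + 2)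
  rw [hd] at hge hlt
  have hpow : (2 * φ) ^ 5 ≤ (2 * φ) ^ (d + 5) := le_two_mul_goldenRatio_pow (by omega)
  rw [two_mul_goldenRatio_pow 4] at hpow
  have hphi : φ ^ 8 ≤ φ ^ (d + 8) := pow_le_pow_right₀ one_lt_goldenRatio.le (by omega)
  rw [goldenRatio_pow_succ 7] at hphi
  norm_num at hpow hphi
  have hpow0 : 0 < (2 * φ) ^ (d + 5) := by positivity
  have hphi0 : 0 < φ ^ (d + 8) := by positivity
  rcases lt_or_ge (ℓ + 2) (2 * (d + 7).fib) with h | h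
  · have hγ := (count_le_of_le (v := (6, 6, 4)) (A := 7.2) (by norm_num; linarith) (by norm_num)
      (by norm_num; linarith) (d + 4)).1
    have hγ' : (γ ℓ : ℝ) ≤ (count (6, 6, 4) (d + 4)).1 := by
      exact_mod_cast γ_le_count_six (d := d + 4) h
    have hb := (abs_le.1 (sqrt_five_mul_fib (d + 8))).1
    have hge' : ((d + 8).fib : ℝ) ≤ ℓ + 2 := by exact_mod_cast hge
    have h1 := mul_le_mul_of_nonneg_left hge' (Real.sqrt_nonneg 5)
    refine (le_trans (hγ'.trans hγ) ?_).trans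
      (le_D_mul_rpow (κ := 0.88) (c := 0.72) (m := d + 6) (by norm_num)
        (le_rpow_α_of_le_one (by norm_num) (by norm_num) (by norm_num) (by norm_num)) ?_)
    · have e : (7.2 : ℝ) * φ * (2 * φ) ^ (d + 4) = 3.6 * (2 * φ) ^ (d + 5) := by
        rw [pow_succ (2 * φ) (d + 4)]; ring
      have e' : (2 * φ) ^ (d + 6) = 2 * φ * (2 * φ) ^ (d + 5) := pow_succ' _ _
      have hmul := mul_le_mul_of_nonneg_right hlo.le (hpow0.le)
      rw [e, e']
      linarith
    · rw [show d + 6 + 2 = d + 8 by ring]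
      linarith
  · have hγ := (count_le_of_le (v := (2, 2, 2)) (A := 3.89) (by norm_num; linarith) (by norm_num)
      (by norm_num; linarith) (d + 5)).1
    have hγ' : (γ ℓ : ℝ) ≤ (count (2, 2, 2) (d + 5)).1 := by
      exact_mod_cast γ_le_count_pair (d := d + 5) hlt
    have hb := (abs_le.1 (sqrt_five_mul_fib (d + 7))).1
    have hge' : (2 * (d + 7).fib : ℝ) ≤ ℓ + 2 := by exact_mod_cast h
    have h1 := mul_le_mul_of_nonneg_left hge' (Real.sqrt_nonneg 5)
    have e8 : φ ^ (d + 7) = (φ - 1) * φ ^ (d + 8) := by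
      rw [pow_succ φ (d + 7)]; linear_combination (-φ ^ (d + 7)) * hsq
    refine (le_trans (hγ'.trans hγ) ?_).trans
      (le_D_mul_rpow (κ := 1.09) (c := 1.22) (m := d + 6) (by norm_num)
        (le_rpow_α_of_one_le (by norm_num) (by norm_num) (by norm_num)) ?_)
    · have e' : (2 * φ) ^ (d + 6) = 2 * φ * (2 * φ) ^ (d + 5) := pow_succ' _ _
      have hmul := mul_le_mul_of_nonneg_right hlo.le (hpow0.le)
      rw [e']
      linarith
    · have hmul := mul_le_mul_of_nonneg_right hlo.le (hphi0.le)
      rw [show d + 6 + 2 = d + 8 by ring]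
      linarith

theorem exists_γ_le_mul : ∃ D' : ℝ, 0 < D' ∧
    ∀ ℓ : ℕ, 1 ≤ ℓ → (γ ℓ : ℝ) ≤ D' * (ℓ : ℝ) ^ α := by
  have hα : 0 ≤ α := by linarith [lt_α]
  refine ⟨max D 6, lt_max_of_lt_right (by norm_num), fun ℓ hℓ => ?_⟩
  rcases lt_or_ge ℓ 3 with h | h
  · have g0 := γ_zero_le
    have g1 := γ_one_le
    have g2 := γ_add_two_le 0
    simp only [zero_add] at g2
    have hγ : γ ℓ ≤ 6 := by
      rcases (by omega : ℓ = 1 ∨ ℓ = 2) with rfl | rfl <;> omega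
    have hγ' : (γ ℓ : ℝ) ≤ 6 := by exact_mod_cast hγ
    have h1 : 1 ≤ (ℓ : ℝ) ^ α := Real.one_le_rpow (by exact_mod_cast hℓ) hα
    have h6 : (6 : ℝ) ≤ max D 6 := le_max_right _ _
    nlinarith
  · exact (γ_le_D_mul h).trans (by gcongr; exact le_max_left _ _)

theorem C_mul_le_γ_small {ℓ : ℕ} (h : ℓ < 25) : C * (ℓ : ℝ) ^ α ≤ γ ℓ := by
  have hlo := lt_goldenRatio
  have hhi := goldenRatio_lt
  have cast : ∀ {n : ℕ}, n ≤ γ ℓ → (n : ℝ) ≤ γ ℓ := fun h => by exact_mod_cast h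
  rcases (by omega : ℓ = 0 ∨ (1 ≤ ℓ ∧ ℓ ≤ 3) ∨ (4 ≤ ℓ ∧ ℓ ≤ 6) ∨ (7 ≤ ℓ ∧ ℓ ≤ 9) ∨
    (10 ≤ ℓ ∧ ℓ ≤ 11) ∨ (12 ≤ ℓ ∧ ℓ ≤ 16) ∨ (17 ≤ ℓ ∧ ℓ ≤ 24)) with
    rfl | ⟨h, h'⟩ | ⟨h, h'⟩ | ⟨h, h'⟩ | ⟨h, h'⟩ | ⟨h, h'⟩ | ⟨h, h'⟩
  · rw [Nat.cast_zero, Real.zero_rpow (by linarith [lt_α]), mul_zero]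
    positivity
  · have hγ : 2 ≤ γ ℓ := count_pair_le_γ (d := 0) (by norm_num; omega)
    refine C_mul_le_γ_of_le (κ := 1) (c := 1) (m := 0) h' (by norm_num)
      (Real.one_rpow α).le ?_ (le_trans ?_ (cast hγ))
    · rw [sqrt_five_eq, goldenRatio_pow_succ]; norm_num; linarith
    · norm_num
  · have hγ : 10 ≤ γ ℓ := count_pair_le_γ (d := 1) (by norm_num; omega)
    refine C_mul_le_γ_of_le (κ := 1) (c := 1) (m := 1) h' (by norm_num)
      (Real.one_rpow α).le ?_ (le_trans ?_ (cast hγ))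
    · rw [sqrt_five_eq, goldenRatio_pow_succ]; norm_num; linarith
    · rw [two_mul_goldenRatio_pow]; norm_num; linarith
  · have hγ : 22 ≤ γ ℓ := count_five_le_γ (d := 1) (by norm_num; omega)
    refine C_mul_le_γ_of_le (κ := 1) (c := 1) (m := 2) h' (by norm_num)
      (Real.one_rpow α).le ?_ (le_trans ?_ (cast hγ))
    · rw [sqrt_five_eq, goldenRatio_pow_succ]; norm_num; linarith
    · rw [two_mul_goldenRatio_pow]; norm_num; linarith
  · have hγ : 42 ≤ γ ℓ := count_pair_le_γ (d := 2) (by norm_num; omega)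
    refine C_mul_le_γ_of_le (κ := 0.7) (c := 0.43) (m := 3) h' (by norm_num)
      (rpow_α_le_of_le_one (by norm_num) (by norm_num) (by norm_num) (by norm_num))
      ?_ (le_trans ?_ (cast hγ))
    · rw [sqrt_five_eq, goldenRatio_pow_succ]; norm_num; linarith
    · rw [two_mul_goldenRatio_pow]; norm_num; linarith
  · have hγ : 82 ≤ γ ℓ := count_five_le_γ (d := 2) (by norm_num; omega)
    refine C_mul_le_γ_of_le (κ := 1) (c := 1) (m := 3) h' (by norm_num)
      (Real.one_rpow α).le ?_ (le_trans ?_ (cast hγ))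
    · rw [sqrt_five_eq, goldenRatio_pow_succ]; norm_num; linarith
    · rw [two_mul_goldenRatio_pow]; norm_num; linarith
  · have hγ : 154 ≤ γ ℓ := count_pair_le_γ (d := 3) (by norm_num; omega)
    refine C_mul_le_γ_of_le (κ := 0.925) (c := 0.85) (m := 4) h' (by norm_num)
      (rpow_α_le_of_le_one (by norm_num) (by norm_num) (by norm_num) (by norm_num))
      ?_ (le_trans ?_ (cast hγ))
    · rw [sqrt_five_eq, goldenRatio_pow_succ]; norm_num; linarith
    · rw [two_mul_goldenRatio_pow]; norm_num; linarith

theorem exists_fib_add_fib {n : ℕ} (hn : 29 ≤ n) :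
    ∃ d, (d + 6).fib + (d + 8).fib ≤ n ∧ n < (d + 7).fib + (d + 9).fib := by
  have hex : ∃ d, n < (d + 7).fib + (d + 9).fib :=
    ⟨n, lt_of_lt_of_le (by have := Nat.le_fib_add_one (n + 9); omega) (Nat.le_add_left _ _)⟩
  refine ⟨Nat.find hex, ?_, Nat.find_spec hex⟩
  by_contra! hlt
  rcases Nat.eq_zero_or_pos (Nat.find hex) with h0 | h0
  · rw [h0] at hlt
    norm_num at hlt
    omega
  · obtain ⟨e, he⟩ : ∃ e, Nat.find hex = e + 1 := ⟨_, (Nat.succ_pred_eq_of_pos h0).symm⟩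
    refine Nat.find_min hex (m := e) (by omega) ?_
    rw [he] at hlt
    exact hlt

theorem sqrt_five_mul_le_of_lt {n ℓ : ℕ} (h : ℓ + 4 < n) {x : ℝ} (hx : √5 * n ≤ x + 2) :
    √5 * ℓ ≤ x := by
  have hle : (ℓ : ℝ) + 5 ≤ n := by exact_mod_cast h
  have h1 := mul_le_mul_of_nonneg_left hle (Real.sqrt_nonneg 5)
  have h5 := sqrt_five_eq
  have := one_lt_goldenRatio
  linarith

theorem C_mul_le_γ_of_lt_fib {d ℓ : ℕ} (hge : (d + 6).fib + (d + 8).fib ≤ ℓ + 4)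
    (h : ℓ + 4 < (d + 9).fib) : C * (ℓ : ℝ) ^ α ≤ γ ℓ := by
  have hlo := lt_goldenRatio
  have hhi := goldenRatio_lt
  have hγ : ((count (1, 1, 1) (d + 4)).1 : ℝ) ≤ γ ℓ := by
    exact_mod_cast count_one_le_γ (d := d + 4) hge
  have hcount := le_count_of_le (v := (1, 1, 1)) (A := 1.936) (d₀ := 4)
    (by rw [two_mul_goldenRatio_pow]; norm_num [count]; nlinarith)
    (by rw [two_mul_goldenRatio_pow]; norm_num [count]; linarith)
    (by rw [two_mul_goldenRatio_pow]; norm_num [count]; nlinarith)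
    (show 4 ≤ d + 4 by omega)
  refine (C_mul_rpow_le (κ := 0.80902) (c := 0.605) (m := d + 5) (by norm_num)
    (rpow_α_le_of_le_one (by norm_num) (by norm_num) (by norm_num) (by norm_num))
    (by positivity) (sqrt_five_mul_le_of_lt h ?_)).trans (le_trans ?_ (hcount.trans hγ))
  · have b9 := (abs_le.1 (sqrt_five_mul_fib (d + 9))).2
    have p9 : φ ^ (d + 9) = φ * φ ^ (d + 8) := pow_succ' _ _
    have hmul := mul_le_mul_of_nonneg_right hhi.le (pow_pos goldenRatio_pos (d + 8)).le
    rw [show d + 5 + 3 = d + 8 by ring]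
    linarith
  · rw [show (2 * φ) ^ (d + 5) = 2 * φ * (2 * φ) ^ (d + 4) from pow_succ' _ _]
    linarith

theorem C_mul_le_γ_of_lt_two_mul_fib {d ℓ : ℕ} (hge : (d + 9).fib ≤ ℓ + 4)
    (h : ℓ + 4 < 2 * (d + 8).fib) : C * (ℓ : ℝ) ^ α ≤ γ ℓ := by
  have hlo := lt_goldenRatio
  have hhi := goldenRatio_lt
  have cast : ∀ {n : ℕ}, n ≤ γ ℓ → (n : ℝ) ≤ γ ℓ := fun h => by exact_mod_cast h
  have hγ := count_pair_le_γ (d := d + 4) hge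
  rcases (by omega : d = 0 ∨ d = 1 ∨ 2 ≤ d) with rfl | rfl | hd
  · norm_num at h
    have hγ : 538 ≤ γ ℓ := hγ
    refine C_mul_le_γ_of_le (ℓ₁ := 37) (κ := 0.89) (c := 0.77) (m := 5) (by omega)
      (by norm_num)
      (rpow_α_le_of_le_one (by norm_num) (by norm_num) (by norm_num) (by norm_num))
      ?_ (le_trans ?_ (cast hγ))
    · rw [sqrt_five_eq, goldenRatio_pow_succ]; norm_num; linarith
    · rw [two_mul_goldenRatio_pow]; norm_num; linarith
  · norm_num at h
    have hγ : 1818 ≤ γ ℓ := hγ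
    refine C_mul_le_γ_of_le (ℓ₁ := 63) (κ := 0.93) (c := 0.85) (m := 6) (by omega)
      (by norm_num)
      (rpow_α_le_of_le_one (by norm_num) (by norm_num) (by norm_num) (by norm_num))
      ?_ (le_trans ?_ (cast hγ))
    · rw [sqrt_five_eq, goldenRatio_pow_succ]; norm_num; linarith
    · rw [two_mul_goldenRatio_pow]; norm_num; linarith
  · have hcount := le_count_of_le (v := (2, 2, 2)) (A := 3.2) (d₀ := 6)
      (by rw [two_mul_goldenRatio_pow]; norm_num [count]; nlinarith)
      (by rw [two_mul_goldenRatio_pow]; norm_num [count]; linarith)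
      (by rw [two_mul_goldenRatio_pow]; norm_num [count]; nlinarith)
      (show 6 ≤ d + 4 by omega)
    refine (C_mul_rpow_le (κ := 1) (c := 1) (m := d + 5) (by norm_num)
      (Real.one_rpow α).le (by positivity) (sqrt_five_mul_le_of_lt h ?_)).trans
      (le_trans ?_ (hcount.trans (cast hγ)))
    · have b8 := (abs_le.1 (sqrt_five_mul_fib (d + 8))).2
      rw [show d + 5 + 3 = d + 8 by ring]
      push_cast
      linarith
    · rw [show (2 * φ) ^ (d + 5) = 2 * φ * (2 * φ) ^ (d + 4) from pow_succ' _ _]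
      linarith

theorem C_mul_le_γ_of_two_mul_fib_le {d ℓ : ℕ} (hge : 2 * (d + 8).fib ≤ ℓ + 4)
    (h : ℓ + 4 < (d + 7).fib + (d + 9).fib) : C * (ℓ : ℝ) ^ α ≤ γ ℓ := by
  have hlo := lt_goldenRatio
  have hhi := goldenRatio_lt
  have hγ : ((count (5, 5, 3) (d + 4)).1 : ℝ) ≤ γ ℓ := by
    exact_mod_cast count_five_le_γ (d := d + 4) hge
  have hcount := le_count_of_le (v := (5, 5, 3)) (A := 4.256) (d₀ := 4)
    (by rw [two_mul_goldenRatio_pow]; norm_num [count]; nlinarith)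
    (by rw [two_mul_goldenRatio_pow]; norm_num [count]; linarith)
    (by rw [two_mul_goldenRatio_pow]; norm_num [count]; nlinarith)
    (show 4 ≤ d + 4 by omega)
  refine (C_mul_rpow_le (κ := 1.1181) (c := 1.33) (m := d + 5) (by norm_num)
    (rpow_α_le_of_one_le (by norm_num) (by norm_num) (by norm_num))
    (by positivity) (sqrt_five_mul_le_of_lt h ?_)).trans (le_trans ?_ (hcount.trans hγ))
  · have b7 := (abs_le.1 (sqrt_five_mul_fib (d + 7))).2
    have b9 := (abs_le.1 (sqrt_five_mul_fib (d + 9))).2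
    have p9 : φ ^ (d + 9) = φ * φ ^ (d + 8) := pow_succ' _ _
    have p7 : φ ^ (d + 7) = (φ - 1) * φ ^ (d + 8) := by
      rw [pow_succ φ (d + 7)]; linear_combination (-φ ^ (d + 7)) * goldenRatio_sq
    have hmul := mul_le_mul_of_nonneg_right hhi.le (pow_pos goldenRatio_pos (d + 8)).le
    have hpos := pow_pos goldenRatio_pos (d + 8)
    rw [show d + 5 + 3 = d + 8 by ring]
    push_cast
    linarith
  · rw [show (2 * φ) ^ (d + 5) = 2 * φ * (2 * φ) ^ (d + 4) from pow_succ' _ _]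
    linarith

theorem C_mul_le_γ (ℓ : ℕ) : C * (ℓ : ℝ) ^ α ≤ γ ℓ := by
  rcases lt_or_ge ℓ 25 with h25 | h25
  · exact C_mul_le_γ_small h25
  obtain ⟨d, hge, hlt⟩ := exists_fib_add_fib (n := ℓ + 4) (by omega)
  rcases lt_or_ge (ℓ + 4) (d + 9).fib with h | h
  · exact C_mul_le_γ_of_lt_fib hge h
  rcases lt_or_ge (ℓ + 4) (2 * (d + 8).fib) with h' | h'
  · exact C_mul_le_γ_of_lt_two_mul_fib h h'
  · exact C_mul_le_γ_of_two_mul_fib_le h' hlt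

end Bounds

end MealyGrowth

theorem mainTheorem1 :
    0 < MealyGrowth.C ∧ 0 < MealyGrowth.D ∧
    (∀ ℓ : ℕ, MealyGrowth.C * (ℓ : ℝ) ^ MealyGrowth.α ≤ (MealyGrowth.γ ℓ : ℝ)) ∧
    (∀ ℓ : ℕ, 3 ≤ ℓ → (MealyGrowth.γ ℓ : ℝ) ≤ MealyGrowth.D * (ℓ : ℝ) ^ MealyGrowth.α) ∧
    (∃ D' : ℝ, 0 < D' ∧
      ∀ ℓ : ℕ, 1 ≤ ℓ → (MealyGrowth.γ ℓ : ℝ) ≤ D' * (ℓ : ℝ) ^ MealyGrowth.α) ∧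
    |MealyGrowth.α - 2.44| < 0.005 ∧
    Irrational MealyGrowth.α ∧
    MealyGrowth.gkDim ({MealyGrowth.s, MealyGrowth.f} : Set (MealyGrowth.RightTransf ℤ)) =
      ((MealyGrowth.α : ℝ) : EReal) ∧
    (∀ Q : Set (MealyGrowth.RightTransf ℤ), Q.Finite →
      Subsemigroup.closure Q = MealyGrowth.F →
      MealyGrowth.gkDim Q = ((MealyGrowth.α : ℝ) : EReal)) := by
  have h1 := MealyGrowth.lt_α
  have h2 := MealyGrowth.α_lt
  obtain ⟨D', hD', hle⟩ := MealyGrowth.exists_γ_le_mul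
  have hdim : ∀ Q : Set (MealyGrowth.RightTransf ℤ), Q.Finite →
      Subsemigroup.closure Q = MealyGrowth.F →
      MealyGrowth.gkDim Q = ((MealyGrowth.α : ℝ) : EReal) := fun Q hQ h =>
    MealyGrowth.gkDim_eq_of_closure_eq hQ MealyGrowth.finite_generators h (by linarith)
      MealyGrowth.C_pos MealyGrowth.C_mul_le_γ hle
  refine ⟨MealyGrowth.C_pos, MealyGrowth.D_pos, MealyGrowth.C_mul_le_γ,
    fun _ => MealyGrowth.γ_le_D_mul, ⟨D', hD', hle⟩, ?_, MealyGrowth.irrational_α,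
    hdim _ MealyGrowth.finite_generators rfl, hdim⟩
  rw [abs_lt]
  constructor <;> norm_num <;> linarith
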